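/- **Problem.** Let $T>0$, let $W^{1,s}([0,T];\mathbb R^n)$ be the space of absolutely continuous functions with derivative in $L^s$, and put $X=W^{1,\infty}([0,T];\mathbb R^n)\times L^\infty([0,T];\mathbb R^m)$, $Y=W^{1,1}([0,T];\mathbb R^n)\times L^1([0,T];\mathbb R^m)$, where $Y$ carries the norm $\|x\|_1+\|\dot x\|_1+\|u\|_1$. Let $X_0\subseteq X$ be convex and closed (relatively to $X$) in the topology of $Y$. Consider $$(\mathcal P)\quad \min_{(x,u)\in X_0} J(x,u)=\int_0^T F_0(x,u,t)\,dt+f_0(x(0),x(T))$$ subject to $\dot x=F(x,u,t)$ a.e., $f_i(x(0),x(T))\le 0$ ($i\in\mathcal I$), $f_j(x(0),x(T))=0$ ($j\in\mathcal E$), and $\Xi_s(x,u,t)\le 0$ a.e. ($s\in\mathcal M$), with finite (possibly empty) index sets, $F$ being $\mathbb R^n$-valued. Here $F_0=G_0-H_0$, $F=G-H$, $\Xi_s=p_s-q_s$, $f_i=g_i-h_i$, where $G_0,H_0,p_s,q_s$ are convex in $(x,u)$, $G,H$ are coordinate-wise convex in $(x,u)$, and $g_i,h_i$ are convex; all are finite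 everywhere. The functions $G_0,H_0,G,H,p_s,q_s$ are Carathéodory; for every $R>0$ their norms, and the norms of all elements of the subdifferentials in $(x,u)$ of $G_0,H_0,p_s,q_s$ and of the coordinates of $G,H$, are bounded by a constant $\gamma_R$ for a.e. $t$ and all $|x|+|u|\le R$; and these subdifferential mappings along any $(x,u)\in X$ are measurable in $t$. **Penalty function and majorants.** Let $\Phi_c=J+c\varphi$ with $$\varphi(x,u)=\sum_{i=1}^n\int_0^T|\dot x_i-F_i(x,u,t)|dt+\sum_{i\in\mathcal I}\max\{0,f_i(x(0),x(T))\}+\sum_{j\in\mathcal E}|f_j(x(0),x(T))|+\sum_{s\in\mathcal M}\int_0^T\max\{0,\Xi_s(x,u,t)\}dt.$$ Write $y=(x,u)$ and $e(y)=(x(0),x(T))$. A collection of subgradients $V$ at $y_*=(x_*,u_*)\in X$ consists of measurable $V_l(t)\in\partial H_l(y_*(t),t)$ ($0\le l\le n$), $W_l(t)\in\partial G_l(y_*(t),t)$ ($1\le l\le n$), $z_s(t)\in\partial q_s(y_*(t),t)$ (for a.e. $t$), and vectors $v_i\in\partial h_i(e(y_*))$ ($i\in\{0\}\cup\mathcal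 I\cup\mathcal E$), $w_j\in\partial g_j(e(y_*))$ ($j\in\mathcal E$). Put $Q_c(y;y_*;V)=\omega(y)+c\,\Gamma(y;y_*;V)$, where $$\omega(y)=\int_0^T\big(G_0(y,t)-\langle V_0,y\rangle\big)dt+g_0(e(y))-\langle v_0,e(y)\rangle,$$ $$\begin{aligned}\Gamma(y;y_*;V)=&\sum_{i=1}^n\int_0^T\max\{\dot x_i+H_i(y,t)-G_i(y_*,t)-\langle W_i,y-y_*\rangle,\ -\dot x_i+G_i(y,t)-H_i(y_*,t)-\langle V_i,y-y_*\rangle\}dt\\&+\sum_{i\in\mathcal I}\max\{0,\,g_i(e(y))-h_i(e(y_*))-\langle v_i,e(y)-e(y_*)\rangle\}\\&+\sum_{j\in\mathcal E}\max\{g_j(e(y))-h_j(e(y_*))-\langle v_j,e(y)-e(y_*)\rangle,\ h_j(e(y))-g_j(e(y_*))-\langle w_j,e(y)-e(y_*)\rangle\}\\&+\sum_{s\in\mathcal M}\int_0^T\max\{0,\,p_s(y,t)-q_s(y_*,t)-\langle z_s,y-y_*\rangle\}dt.\end{aligned}$$ A point $y_*\in X_0$ is an $\varepsilon$-optimal solution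 of $\min_{X_0}f$ if $f(y_*)\le\inf_{X_0}f+\varepsilon$. It is a *generalised $\varepsilon$-critical point* for the penalty parameter $c$ if for some collection $V$ of subgradients at $y_*$ it is an $\varepsilon$-optimal solution of $\min_{X_0}Q_c(\cdot;y_*;V)$. A feasible $y_*$ is *$\varepsilon$-critical* if there are such a $V$ and $c_*>0$ for which this holds for all $c\ge c_*$. **B-STEP-DCA.** Let $\eta_1,\eta_2,\zeta,\sigma\in(0,1)$, $\varepsilon_\varphi,\varepsilon_{feas}>0$, $\varepsilon_k>0$, $y_0=(x_0,u_0)\in X_0$, $c_0>0$. In iteration $k$ choose a collection $V_k$ of subgradients at $y_k$; write $\Gamma_k=\Gamma(\cdot;y_k;V_k)$ and let $y_k[c]$ denote a computed $\varepsilon_k$-optimal solution of $\min_{X_0}Q_c(\cdot;y_k;V_k)$ (recomputed each time $c$ is increased). 1. Put $c_+=c_k$ and compute $y_k[c_+]$. If $\Gamma_k(y_k[c_+])\le\varepsilon_\varphi$, go to 4. 2. Otherwise compute an $\varepsilon_k$-optimal solution $\hat y_k$ of $\min_{X_0}\Gamma_k$. If $\Gamma_k(\hat y_k)<\Gamma_k(y_k)$,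 go to 3. Otherwise increase $c_+$ as long as $\Gamma_k(y_k[c_+])\le\Gamma_k(y_k)+\varepsilon_{feas}$ fails, then go to 4. 3. Increase $c_+$ as long as $\Gamma_k(y_k[c_+])-\Gamma_k(y_k)\le\eta_1(\Gamma_k(\hat y_k)-\Gamma_k(y_k))$ fails. 4. Put $c_{k+1}=c_+$ and increase $c_{k+1}$ as long as $Q_{c_{k+1}}(y_k[c_{k+1}];y_k;V_k)-Q_{c_{k+1}}(y_k;y_k;V_k)\le c_{k+1}\eta_2(\Gamma_k(y_k[c_{k+1}])-\Gamma_k(y_k))$ fails. 5. Put $d_k=y_k[c_{k+1}]-y_k$, choose $\nu_k>0$, $\overline\alpha_k\ge0$, let $j_k\ge0$ be the smallest integer $j$ such that $\Phi_{c_{k+1}}(y_k[c_{k+1}]+\zeta^{j}\overline\alpha_kd_k)-\Phi_{c_{k+1}}(y_k[c_{k+1}])\le-\sigma(\zeta^{j}\overline\alpha_k)^2\|d_k\|_2^2+\nu_k$, and set $y_{k+1}=y_k[c_{k+1}]+\zeta^{j_k}\overline\alpha_kd_k$. It is assumed that: every computed $y_k[c]$ satisfies $Q_c(y_k[c];y_k;V_k)\le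 Q_c(y_k;y_k;V_k)$; $y_k[c_{k+1}]+\zeta^j\overline\alpha_kd_k\in X_0$ for all $j\ge 0$ and all $k$; there is $\varkappa>0$ such that each increase of the penalty parameter is at least $\varkappa$; and $\Phi_{c_0}$ is bounded below on $X_0$. **Theorem.** Let an infinite sequence $\{(x_k,u_k)\}$ be generated by B-STEP-DCA and suppose that 1. $\{c_k\}$ and $\{\varepsilon_k\}$ are bounded; 2. $\sum_k\nu_k<+\infty$ and $\limsup_{k\to\infty}\varepsilon_k=\varepsilon_*$; 3. $\{u_k\}$ is bounded in $L^\infty([0,T];\mathbb R^m)$; 4. $G_i,H_i$ ($1\le i\le n$) and $q_s$ ($s\in\mathcal M$) are differentiable in $(x,u)$ for a.e. $t$, and their partial derivatives in $x$ and $u$ are Carathéodory mappings. Then $c_k$ is eventually equal to a constant $c_*>0$, and every limit point $(x_*,u_*)\in X$ of $\{(x_k,u_k)\}$ in $Y$ is a generalised $\varepsilon_*$-critical point of $(\mathcal P)$ for the penalty parameter $c_*$. If, furthermore, $(x_*,u_*)$ is feasible for $(\mathcal P)$, then it is an $\varepsilon_*$-critical point of $(\mathcal P)$. -/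

import Mathlib

open MeasureTheory Filter Topology Set
open scoped ENNReal

noncomputable section

namespace BStepDCA

/-- Euclidean space `ℝⁿ`. -/
abbrev E (n : ℕ) : Type := EuclideanSpace ℝ (Fin n)

/-- `ℝⁿ × ℝᵐ` with the Euclidean inner product and norm of `ℝⁿ⁺ᵐ`. -/
abbrev E2 (n m : ℕ) : Type := WithLp 2 (E n × E m)

/-- Lebesgue measure on `[0, T]`. -/
def timeMeasure (T : ℝ) : Measure ℝ := volume.restrict (Icc 0 T)

/-! ### Function spaces -/

/-- Membership in `W^{1,s}([0, T]; ℝⁿ)`: absolutely continuous functions whose (almost everywhere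
existing) derivative belongs to `Lˢ`. Only the values on `[0, T]` matter. -/
def MemW1 {n : ℕ} (s : ℝ≥0∞) (T : ℝ) (x : ℝ → E n) : Prop :=
  AbsolutelyContinuousOnInterval x 0 T ∧ MemLp (deriv x) s (timeMeasure T)

/-- A pair `(x, u)` of a state trajectory and a control (representatives of elements of function
spaces on `[0, T]`). -/
abbrev StateControl (n m : ℕ) : Type := (ℝ → E n) × (ℝ → E m)

/-- The space `X = W^{1,∞}([0, T]; ℝⁿ) × L^∞([0, T]; ℝᵐ)`, as a set of representatives. -/
def spaceX (n m : ℕ) (T : ℝ) : Set (StateControl n m) :=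
  {z | MemW1 ∞ T z.1 ∧ MemLp z.2 ∞ (timeMeasure T)}

/-- The norm of `Y = W^{1,1}([0, T]; ℝⁿ) × L¹([0, T]; ℝᵐ)`. -/
def normY {n m : ℕ} (T : ℝ) (z : StateControl n m) : ℝ :=
  (∫ t, ‖z.1 t‖ ∂timeMeasure T) + (∫ t, ‖deriv z.1 t‖ ∂timeMeasure T)
    + ∫ t, ‖z.2 t‖ ∂timeMeasure T

/-- The `L²` norm of `(x, u)` as an `ℝⁿ⁺ᵐ`-valued function on `[0, T]`. -/
def norm2 {n m : ℕ} (T : ℝ) (z : StateControl n m) : ℝ :=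
  Real.sqrt (∫ t, (‖z.1 t‖ ^ 2 + ‖z.2 t‖ ^ 2) ∂timeMeasure T)

/-- A subset of `X` is closed (relatively to `X`) in the topology of `Y`. Since points at zero
`Y`-distance from the set belong to it, such a set does not distinguish between representatives
of the same element of `X`. -/
def IsClosedInY {n m : ℕ} (T : ℝ) (S : Set (StateControl n m)) : Prop :=
  ∀ z ∈ spaceX n m T, (∀ δ > 0, ∃ w ∈ S, normY T (w - z) < δ) → z ∈ S

/-- `zs` is a limit point of the sequence `z` in `Y`: some subsequence converges to it. -/
def IsLimitPointInY {n m : ℕ} (T : ℝ) (z : ℕ → StateControl n m) (zs : StateControl n m) : Prop :=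
  ∃ κ : ℕ → ℕ, StrictMono κ ∧ Tendsto (fun l => normY T (z (κ l) - zs)) atTop (𝓝 0)

/-- The value `(x(t), u(t))`. -/
def pt {n m : ℕ} (z : StateControl n m) (t : ℝ) : E2 n m := WithLp.toLp 2 (z.1 t, z.2 t)

/-- The pair of end-points `(x(0), x(T))`. -/
def ends {n m : ℕ} (T : ℝ) (z : StateControl n m) : E2 n n := WithLp.toLp 2 (z.1 0, z.1 T)

/-! ### Convex analysis and measurability -/

/-- The subdifferential of `f` at `x` in the sense of convex analysis. -/
def subdiff {W : Type*} [NormedAddCommGroup W] [InnerProductSpace ℝ W] (f : W → ℝ) (x : W) :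
    Set W :=
  {v | ∀ y, f x + inner ℝ v (y - x) ≤ f y}

/-- Carathéodory mappings on `W × [0, T]` (measurability in `t` is Lebesgue measurability). -/
def IsCaratheodory {W F : Type*} [TopologicalSpace W] [TopologicalSpace F] (T : ℝ)
    (f : W → ℝ → F) : Prop :=
  (∀ᵐ t ∂timeMeasure T, Continuous fun y => f y t) ∧
    ∀ y, AEStronglyMeasurable (fun t => f y t) (timeMeasure T)

/-- (Lebesgue) measurability on `[0, T]` of a set-valued mapping. -/
def IsMeasurableMultimap {W : Type*} [TopologicalSpace W] (T : ℝ) (S : ℝ → Set W) : Prop :=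
  ∀ O : Set W, IsOpen O → NullMeasurableSet {t | (S t ∩ O).Nonempty} (timeMeasure T)

/-- `z` is an `ε`-optimal solution of the problem of minimising `f` over `S`. -/
def IsEpsOptimal {α : Type*} (S : Set α) (f : α → ℝ) (ε : ℝ) (z : α) : Prop :=
  z ∈ S ∧ ∀ w ∈ S, f z ≤ f w + ε

/-! ### The optimal control problem -/

/-- The data of the problem: the horizon `T`, the set `X₀`, and the DC decompositions
`F₀ = G₀ - H₀`, `F = G - H`, `f₀ = g₀ - h₀`, `f_i = gI_i - hI_i` (inequality end-point constraints),
`f_j = gE_j - hE_j` (equality end-point constraints), `Ξ_s = p_s - q_s`. -/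
structure DCProblem (n m ℓI ℓE ℓM : ℕ) where
  T : ℝ
  X0 : Set (StateControl n m)
  G0 : E2 n m → ℝ → ℝ
  H0 : E2 n m → ℝ → ℝ
  G : E2 n m → ℝ → E n
  H : E2 n m → ℝ → E n
  p : Fin ℓM → E2 n m → ℝ → ℝ
  q : Fin ℓM → E2 n m → ℝ → ℝ
  g0 : E2 n n → ℝ
  h0 : E2 n n → ℝ
  gI : Fin ℓI → E2 n n → ℝ
  hI : Fin ℓI → E2 n n → ℝ
  gE : Fin ℓE → E2 n n → ℝ
  hE : Fin ℓE → E2 n n → ℝ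

/-- A collection of (candidate) subgradients `V = (V₀, V_i, W_i, v₀, v_i, w_j, z_s)`. -/
structure SubgradCollection (n m ℓI ℓE ℓM : ℕ) where
  V0 : ℝ → E2 n m
  V : Fin n → ℝ → E2 n m
  W : Fin n → ℝ → E2 n m
  zq : Fin ℓM → ℝ → E2 n m
  v0 : E2 n n
  vI : Fin ℓI → E2 n n
  vE : Fin ℓE → E2 n n
  wE : Fin ℓE → E2 n n

namespace DCProblem

variable {n m ℓI ℓE ℓM : ℕ} (P : DCProblem n m ℓI ℓE ℓM)

/-- Standing assumptions on the data of the problem. -/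
structure Standing : Prop where
  T_pos : 0 < P.T
  X0_subset : P.X0 ⊆ spaceX n m P.T
  X0_convex : Convex ℝ P.X0
  X0_closed : IsClosedInY P.T P.X0
  -- convexity of the components of the DC decompositions
  G0_convex : ∀ t ∈ Icc 0 P.T, ConvexOn ℝ univ fun y => P.G0 y t
  H0_convex : ∀ t ∈ Icc 0 P.T, ConvexOn ℝ univ fun y => P.H0 y t
  G_convex : ∀ t ∈ Icc 0 P.T, ∀ i, ConvexOn ℝ univ fun y => P.G y t i
  H_convex : ∀ t ∈ Icc 0 P.T, ∀ i, ConvexOn ℝ univ fun y => P.H y t i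
  p_convex : ∀ t ∈ Icc 0 P.T, ∀ s, ConvexOn ℝ univ fun y => P.p s y t
  q_convex : ∀ t ∈ Icc 0 P.T, ∀ s, ConvexOn ℝ univ fun y => P.q s y t
  g0_convex : ConvexOn ℝ univ P.g0
  h0_convex : ConvexOn ℝ univ P.h0
  gI_convex : ∀ i, ConvexOn ℝ univ (P.gI i)
  hI_convex : ∀ i, ConvexOn ℝ univ (P.hI i)
  gE_convex : ∀ j, ConvexOn ℝ univ (P.gE j)
  hE_convex : ∀ j, ConvexOn ℝ univ (P.hE j)
  -- Carathéodory conditions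
  G0_carath : IsCaratheodory P.T P.G0
  H0_carath : IsCaratheodory P.T P.H0
  G_carath : IsCaratheodory P.T P.G
  H_carath : IsCaratheodory P.T P.H
  p_carath : ∀ s, IsCaratheodory P.T (P.p s)
  q_carath : ∀ s, IsCaratheodory P.T (P.q s)
  -- growth condition
  growth : ∀ R > 0, ∃ γ > 0, ∀ᵐ t ∂timeMeasure P.T, ∀ y : E2 n m, ‖y.fst‖ + ‖y.snd‖ ≤ R →
    |P.G0 y t| ≤ γ ∧ |P.H0 y t| ≤ γ ∧ ‖P.G y t‖ ≤ γ ∧ ‖P.H y t‖ ≤ γ ∧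
      ∀ s, |P.p s y t| ≤ γ ∧ |P.q s y t| ≤ γ
  -- measurability of the subdifferential mappings along elements of `X`
  subdiff_meas : ∀ z ∈ spaceX n m P.T,
    IsMeasurableMultimap P.T (fun t => subdiff (fun y => P.G0 y t) (pt z t)) ∧
    IsMeasurableMultimap P.T (fun t => subdiff (fun y => P.H0 y t) (pt z t)) ∧
    (∀ i, IsMeasurableMultimap P.T (fun t => subdiff (fun y => P.G y t i) (pt z t))) ∧
    (∀ i, IsMeasurableMultimap P.T (fun t => subdiff (fun y => P.H y t i) (pt z t))) ∧
    (∀ s, IsMeasurableMultimap P.T (fun t => subdiff (fun y => P.p s y t) (pt z t))) ∧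
    (∀ s, IsMeasurableMultimap P.T (fun t => subdiff (fun y => P.q s y t) (pt z t)))
  -- local boundedness of the subgradients, uniformly in `t`
  subdiff_bound : ∀ R > 0, ∃ γ > 0, ∀ᵐ t ∂timeMeasure P.T, ∀ y : E2 n m,
    ‖y.fst‖ + ‖y.snd‖ ≤ R →
    (∀ v ∈ subdiff (fun y => P.G0 y t) y ∪ subdiff (fun y => P.H0 y t) y, ‖v‖ ≤ γ) ∧
    (∀ i, ∀ v ∈ subdiff (fun y => P.G y t i) y ∪ subdiff (fun y => P.H y t i) y, ‖v‖ ≤ γ) ∧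
    (∀ s, ∀ v ∈ subdiff (fun y => P.p s y t) y ∪ subdiff (fun y => P.q s y t) y, ‖v‖ ≤ γ)

/-- The cost functional `J(x, u) = ∫₀ᵀ F₀(x(t), u(t), t) dt + f₀(x(0), x(T))`. -/
def J (z : StateControl n m) : ℝ :=
  (∫ t, (P.G0 (pt z t) t - P.H0 (pt z t) t) ∂timeMeasure P.T)
    + (P.g0 (ends P.T z) - P.h0 (ends P.T z))

/-- Feasible points of the problem. -/
structure IsFeasible (z : StateControl n m) : Prop where
  mem : z ∈ P.X0
  dynamics : ∀ᵐ t ∂timeMeasure P.T, deriv z.1 t = P.G (pt z t) t - P.H (pt z t) t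
  ineq : ∀ i, P.gI i (ends P.T z) - P.hI i (ends P.T z) ≤ 0
  eq : ∀ j, P.gE j (ends P.T z) - P.hE j (ends P.T z) = 0
  mixed : ∀ s, ∀ᵐ t ∂timeMeasure P.T, P.p s (pt z t) t - P.q s (pt z t) t ≤ 0

/-- The `L¹` penalty term `φ`. -/
def phi (z : StateControl n m) : ℝ :=
  (∑ i, ∫ t, |deriv z.1 t i - (P.G (pt z t) t i - P.H (pt z t) t i)| ∂timeMeasure P.T)
    + (∑ i, max 0 (P.gI i (ends P.T z) - P.hI i (ends P.T z)))
    + (∑ j, |P.gE j (ends P.T z) - P.hE j (ends P.T z)|)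
    + ∑ s, ∫ t, max 0 (P.p s (pt z t) t - P.q s (pt z t) t) ∂timeMeasure P.T

/-- The penalty function `Φ_c = J + c φ`. -/
def Phi (c : ℝ) (z : StateControl n m) : ℝ := P.J z + c * P.phi z

/-- `V` is a collection of (measurable) subgradients at the point `zs = (x_*, u_*)`. -/
structure IsSubgrad (zs : StateControl n m) (V : SubgradCollection n m ℓI ℓE ℓM) : Prop where
  V0_meas : AEStronglyMeasurable V.V0 (timeMeasure P.T)
  V_meas : ∀ i, AEStronglyMeasurable (V.V i) (timeMeasure P.T)
  W_meas : ∀ i, AEStronglyMeasurable (V.W i) (timeMeasure P.T)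
  zq_meas : ∀ s, AEStronglyMeasurable (V.zq s) (timeMeasure P.T)
  V0_mem : ∀ᵐ t ∂timeMeasure P.T, V.V0 t ∈ subdiff (fun y => P.H0 y t) (pt zs t)
  V_mem : ∀ i, ∀ᵐ t ∂timeMeasure P.T, V.V i t ∈ subdiff (fun y => P.H y t i) (pt zs t)
  W_mem : ∀ i, ∀ᵐ t ∂timeMeasure P.T, V.W i t ∈ subdiff (fun y => P.G y t i) (pt zs t)
  zq_mem : ∀ s, ∀ᵐ t ∂timeMeasure P.T, V.zq s t ∈ subdiff (fun y => P.q s y t) (pt zs t)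
  v0_mem : V.v0 ∈ subdiff P.h0 (ends P.T zs)
  vI_mem : ∀ i, V.vI i ∈ subdiff (P.hI i) (ends P.T zs)
  vE_mem : ∀ j, V.vE j ∈ subdiff (P.hE j) (ends P.T zs)
  wE_mem : ∀ j, V.wE j ∈ subdiff (P.gE j) (ends P.T zs)

/-- The convexified cost functional (the part of `Q_c` that does not depend on `c`). -/
def omega (V : SubgradCollection n m ℓI ℓE ℓM) (z : StateControl n m) : ℝ :=
  (∫ t, (P.G0 (pt z t) t - inner ℝ (V.V0 t) (pt z t)) ∂timeMeasure P.T)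
    + (P.g0 (ends P.T z) - inner ℝ V.v0 (ends P.T z))

/-- The convexified infeasibility measure `Γ(z; zs; V)`. -/
def Gam (zs : StateControl n m) (V : SubgradCollection n m ℓI ℓE ℓM) (z : StateControl n m) : ℝ :=
  (∑ i, ∫ t, max
      (deriv z.1 t i + P.H (pt z t) t i - P.G (pt zs t) t i
        - inner ℝ (V.W i t) (pt z t - pt zs t))
      (-deriv z.1 t i + P.G (pt z t) t i - P.H (pt zs t) t i
        - inner ℝ (V.V i t) (pt z t - pt zs t)) ∂timeMeasure P.T)
    + (∑ i, max 0 (P.gI i (ends P.T z) - P.hI i (ends P.T zs)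
        - inner ℝ (V.vI i) (ends P.T z - ends P.T zs)))
    + (∑ j, max
        (P.gE j (ends P.T z) - P.hE j (ends P.T zs)
          - inner ℝ (V.vE j) (ends P.T z - ends P.T zs))
        (P.hE j (ends P.T z) - P.gE j (ends P.T zs)
          - inner ℝ (V.wE j) (ends P.T z - ends P.T zs)))
    + ∑ s, ∫ t, max 0 (P.p s (pt z t) t - P.q s (pt zs t) t
        - inner ℝ (V.zq s t) (pt z t - pt zs t)) ∂timeMeasure P.T

/-- The convex function `Q_c(z; zs; V)`. -/
def Q (c : ℝ) (zs : StateControl n m) (V : SubgradCollection n m ℓI ℓE ℓM) (z : StateControl n m) : ℝ :=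
  P.omega V z + c * P.Gam zs V z

/-- Generalised `ε`-critical points for a given value `c` of the penalty parameter. -/
def IsGenEpsCritical (c ε : ℝ) (zs : StateControl n m) : Prop :=
  zs ∈ P.X0 ∧ ∃ V, P.IsSubgrad zs V ∧ IsEpsOptimal P.X0 (P.Q c zs V) ε zs

/-- `ε`-critical points. -/
def IsEpsCritical (ε : ℝ) (zs : StateControl n m) : Prop :=
  P.IsFeasible zs ∧ ∃ V, P.IsSubgrad zs V ∧
    ∃ cs > 0, ∀ c ≥ cs, IsEpsOptimal P.X0 (P.Q c zs V) ε zs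

/-- The functions `G_i`, `H_i` and `q_s` are differentiable in `(x, u)` for a.e. `t`, and their
partial derivatives are Carathéodory mappings. -/
structure SmoothParts : Prop where
  G_diff : ∀ i, ∀ᵐ t ∂timeMeasure P.T, Differentiable ℝ fun y => P.G y t i
  G_grad : ∀ i, IsCaratheodory P.T fun y t => gradient (fun y' => P.G y' t i) y
  H_diff : ∀ i, ∀ᵐ t ∂timeMeasure P.T, Differentiable ℝ fun y => P.H y t i
  H_grad : ∀ i, IsCaratheodory P.T fun y t => gradient (fun y' => P.H y' t i) y
  q_diff : ∀ s, ∀ᵐ t ∂timeMeasure P.T, Differentiable ℝ fun y => P.q s y t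
  q_grad : ∀ s, IsCaratheodory P.T fun y t => gradient (fun y' => P.q s y' t) y

end DCProblem

/-! ### The algorithm -/

/-- `b` is the first index `r ≥ a` with `p r` (the exit of a while-loop entered at `a`). -/
def IsFirstFrom (p : ℕ → Prop) (a b : ℕ) : Prop :=
  a ≤ b ∧ p b ∧ ∀ r, a ≤ r → r < b → ¬ p r

/-- An infinite run of B-STEP-DCA (no stopping criterion is ever met). In iteration `k` the method
tries the penalty parameters `cTry k 0 < cTry k 1 < ⋯ < cTry k (N k)` with the corresponding
approximate solutions `zTry k r` of the convex penalised subproblem. Index `0` belongs to Step 1,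
the value of `c₊` on leaving Steps 1-3 has index `M k`, and the value `c_{k+1}` on leaving Step 4
has index `N k`. -/
structure Run {n m ℓI ℓE ℓM : ℕ} (P : DCProblem n m ℓI ℓE ℓM) where
  -- parameters
  η₁ : ℝ
  η₂ : ℝ
  ζ : ℝ
  σ : ℝ
  εφ : ℝ
  εfeas : ℝ
  hη₁ : η₁ ∈ Ioo (0 : ℝ) 1
  hη₂ : η₂ ∈ Ioo (0 : ℝ) 1
  hζ : ζ ∈ Ioo (0 : ℝ) 1
  hσ : σ ∈ Ioo (0 : ℝ) 1
  hεφ : 0 < εφ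
  hεfeas : 0 < εfeas
  -- optimality tolerances
  ε : ℕ → ℝ
  hε : ∀ k, 0 < ε k
  -- iterates `(x_k, u_k)`, penalty parameters and subgradients
  z : ℕ → StateControl n m
  c : ℕ → ℝ
  V : ℕ → SubgradCollection n m ℓI ℓE ℓM
  z_zero_mem : z 0 ∈ P.X0
  c_zero_pos : 0 < c 0
  V_subgrad : ∀ k, P.IsSubgrad (z k) (V k)
  -- trial penalty parameters and approximate solutions of the penalised subproblems
  cTry : ℕ → ℕ → ℝ
  zTry : ℕ → ℕ → StateControl n m
  M : ℕ → ℕ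
  N : ℕ → ℕ
  cTry_zero : ∀ k, cTry k 0 = c k
  cTry_lt : ∀ k, ∀ r < N k, cTry k r < cTry k (r + 1)
  zTry_opt : ∀ k, ∀ r ≤ N k, IsEpsOptimal P.X0 (P.Q (cTry k r) (z k) (V k)) (ε k) (zTry k r)
  -- Step 1
  step1 : ∀ k, P.Gam (z k) (V k) (zTry k 0) ≤ εφ → M k = 0
  -- Steps 2 and 3; `zHat k` is the approximate solution of the optimal infeasibility subproblem
  zHat : ℕ → StateControl n m
  zHat_opt : ∀ k, εφ < P.Gam (z k) (V k) (zTry k 0) →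
    IsEpsOptimal P.X0 (P.Gam (z k) (V k)) (ε k) (zHat k)
  step2 : ∀ k, εφ < P.Gam (z k) (V k) (zTry k 0) →
    ¬ P.Gam (z k) (V k) (zHat k) < P.Gam (z k) (V k) (z k) →
    IsFirstFrom (fun r => P.Gam (z k) (V k) (zTry k r) ≤ P.Gam (z k) (V k) (z k) + εfeas) 0 (M k)
  step3 : ∀ k, εφ < P.Gam (z k) (V k) (zTry k 0) →
    P.Gam (z k) (V k) (zHat k) < P.Gam (z k) (V k) (z k) →
    IsFirstFrom (fun r => P.Gam (z k) (V k) (zTry k r) - P.Gam (z k) (V k) (z k)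
      ≤ η₁ * (P.Gam (z k) (V k) (zHat k) - P.Gam (z k) (V k) (z k))) 0 (M k)
  -- Step 4
  step4 : ∀ k, IsFirstFrom (fun r =>
    P.Q (cTry k r) (z k) (V k) (zTry k r) - P.Q (cTry k r) (z k) (V k) (z k)
      ≤ cTry k r * η₂ * (P.Gam (z k) (V k) (zTry k r) - P.Gam (z k) (V k) (z k))) (M k) (N k)
  c_succ : ∀ k, c (k + 1) = cTry k (N k)
  -- Step 5: line search tolerances, trial step sizes and the nonmonotone line search
  ν : ℕ → ℝ
  hν : ∀ k, 0 < ν k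
  αbar : ℕ → ℝ
  hαbar : ∀ k, 0 ≤ αbar k
  j : ℕ → ℕ
  step5 : ∀ k, IsFirstFrom (fun i =>
    P.Phi (c (k + 1)) (zTry k (N k) + (ζ ^ i * αbar k) • (zTry k (N k) - z k))
        - P.Phi (c (k + 1)) (zTry k (N k))
      ≤ -σ * (ζ ^ i * αbar k) ^ 2 * norm2 P.T (zTry k (N k) - z k) ^ 2 + ν k) 0 (j k)
  z_succ : ∀ k, z (k + 1) = zTry k (N k) + (ζ ^ j k * αbar k) • (zTry k (N k) - z k)

namespace Run

variable {n m ℓI ℓE ℓM : ℕ} {P : DCProblem n m ℓI ℓE ℓM} (A : Run P)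

/-- The computed approximate solutions of the penalised subproblems are not worse than the
current iterate. -/
def NoWorse : Prop :=
  ∀ k, ∀ r ≤ A.N k, P.Q (A.cTry k r) (A.z k) (A.V k) (A.zTry k r)
    ≤ P.Q (A.cTry k r) (A.z k) (A.V k) (A.z k)

/-- All points examined by the line search belong to `X₀`. -/
def TrialStepsAdmissible : Prop :=
  ∀ k i, A.zTry k (A.N k) + (A.ζ ^ i * A.αbar k) • (A.zTry k (A.N k) - A.z k) ∈ P.X0

/-- Whenever the penalty parameter is increased, it is increased at least by a fixed `ϰ > 0`. -/
def UniformIncrease : Prop :=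
  ∃ ϰ > 0, ∀ k, ∀ r < A.N k, A.cTry k r + ϰ ≤ A.cTry k (r + 1)

end Run

end BStepDCA

end

/-! Every penalty increase is at least `ϰ` and the penalty parameters are bounded, so only finitely
many increases occur: from some `K` on, `N k = 0` and `c k` is a constant `c_*`
(`exists_penalty_const`).

The subproblem majorises the penalty function. Subgradient inequalities give `φ ≤ Γ` with equality
at the base point, and `J(y) - J(y_k) ≤ ω(y) - ω(y_k)`; hence the decrease `δ_k ≥ 0` of `Q` achieved
by the subproblem bounds from below the decrease of `Φ_{c_*}` (`Phi_sub_le_Q_sub`). The line search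
loses at most `ν_k`, so `δ_k ≤ Φ(y_k) - Φ(y_{k+1}) + ν_k`. Since `Φ_{c_*} ≥ Φ_{c_0}` is bounded
below and `∑ ν_k` is finite, telescoping gives `δ_k → 0` (`tendsto_decrease`). Thus `y_k` is itself
`(ε_k + δ_k)`-optimal for its own convex subproblem.

It remains to pass to the limit in this near-optimality (`isGenEpsCritical_of_tendsto`). Along a
subsequence the points converge boundedly almost everywhere, the end-points converge, and the
derivatives converge in `L¹`. The subgradients are of three types. Those under the integrals of `Γ`
sit inside a maximum, where weak convergence would not suffice; by smoothness they are gradients and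
converge almost everywhere. `V₀` enters `ω` linearly, so a weak `L²` limit is enough, and that limit
is again a subgradient. End-point subgradients are bounded in finite dimension, hence compact.

If the limit is feasible, then `Γ` vanishes there and is nonnegative on `X₀`, so raising `c`
preserves `ε`-optimality. -/

noncomputable section

namespace BStepDCA

/-! ### Bounded almost everywhere convergence and weak compactness in `L²` -/

section BoundedConvergence

variable {α W F : Type*} [MeasurableSpace α] {μ : Measure α}
  [NormedAddCommGroup W] [NormedAddCommGroup F]

/-- A uniformly essentially bounded sequence of measurable functions that converges almost
everywhere. -/
structure BddTendsto (μ : Measure α) (f : ℕ → α → W) (g : α → W) : Prop where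
  meas : ∀ l, AEStronglyMeasurable (f l) μ
  bdd : ∃ C : ℝ, ∀ l, ∀ᵐ t ∂μ, ‖f l t‖ ≤ C
  lim : ∀ᵐ t ∂μ, Tendsto (fun l => f l t) atTop (𝓝 (g t))

theorem exists_ae_norm_le {f : α → W} (hf : MemLp f ∞ μ) : ∃ C : ℝ, ∀ᵐ t ∂μ, ‖f t‖ ≤ C := by
  refine ⟨(eLpNorm f ∞ μ).toReal, ?_⟩
  have h := enorm_ae_le_eLpNormEssSup f μ
  filter_upwards [h] with t ht
  have h2 := hf.2
  rw [eLpNorm_exponent_top] at h2 ⊢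
  rw [← toReal_enorm]
  exact ENNReal.toReal_mono h2.ne ht

theorem BddTendsto.const {f : α → W} (hf : MemLp f ∞ μ) : BddTendsto μ (fun _ => f) f where
  meas _ := hf.1
  bdd := let ⟨C, hC⟩ := exists_ae_norm_le hf; ⟨C, fun _ => hC⟩
  lim := ae_of_all _ fun _ => tendsto_const_nhds

namespace BddTendsto

variable {f f' : ℕ → α → W} {g g' : α → W}

theorem memLp (h : BddTendsto μ f g) (l : ℕ) : MemLp (f l) ∞ μ :=
  let ⟨C, hC⟩ := h.bdd
  memLp_top_of_bound (h.meas l) C (hC l)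

theorem memLp_lim (h : BddTendsto μ f g) : MemLp g ∞ μ := by
  obtain ⟨C, hC⟩ := h.bdd
  refine memLp_top_of_bound (aestronglyMeasurable_of_tendsto_ae atTop h.meas h.lim) C ?_
  filter_upwards [h.lim, ae_all_iff.2 hC] with t ht hb
  exact le_of_tendsto ht.norm (Eventually.of_forall hb)

theorem comp_subseq (h : BddTendsto μ f g) {κ : ℕ → ℕ} (hκ : Tendsto κ atTop atTop) :
    BddTendsto μ (fun l => f (κ l)) g where
  meas _ := h.meas _
  bdd := let ⟨C, hC⟩ := h.bdd; ⟨C, fun _ => hC _⟩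
  lim := h.lim.mono fun _ ht => ht.comp hκ

theorem add (h : BddTendsto μ f g) (h' : BddTendsto μ f' g') :
    BddTendsto μ (fun l t => f l t + f' l t) (fun t => g t + g' t) where
  meas l := (h.meas l).add (h'.meas l)
  bdd := by
    obtain ⟨C, hC⟩ := h.bdd
    obtain ⟨C', hC'⟩ := h'.bdd
    refine ⟨C + C', fun l => ?_⟩
    filter_upwards [hC l, hC' l] with t h1 h2
    exact (norm_add_le _ _).trans (add_le_add h1 h2)
  lim := by filter_upwards [h.lim, h'.lim] with t h1 h2 using h1.add h2

theorem sub (h : BddTendsto μ f g) (h' : BddTendsto μ f' g') :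
    BddTendsto μ (fun l t => f l t - f' l t) (fun t => g t - g' t) where
  meas l := (h.meas l).sub (h'.meas l)
  bdd := by
    obtain ⟨C, hC⟩ := h.bdd
    obtain ⟨C', hC'⟩ := h'.bdd
    refine ⟨C + C', fun l => ?_⟩
    filter_upwards [hC l, hC' l] with t h1 h2
    exact (norm_sub_le _ _).trans (add_le_add h1 h2)
  lim := by filter_upwards [h.lim, h'.lim] with t h1 h2 using h1.sub h2

theorem neg (h : BddTendsto μ f g) : BddTendsto μ (fun l t => -f l t) (fun t => -g t) where
  meas l := (h.meas l).neg
  bdd := by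
    obtain ⟨C, hC⟩ := h.bdd
    exact ⟨C, fun l => (hC l).mono fun t ht => by rwa [norm_neg]⟩
  lim := h.lim.mono fun _ ht => ht.neg

theorem norm (h : BddTendsto μ f g) : BddTendsto μ (fun l t => ‖f l t‖) (fun t => ‖g t‖) where
  meas l := (h.meas l).norm
  bdd := by
    obtain ⟨C, hC⟩ := h.bdd
    exact ⟨C, fun l => (hC l).mono fun t ht => by rwa [norm_norm]⟩
  lim := h.lim.mono fun _ ht => ht.norm

theorem max {f f' : ℕ → α → ℝ} {g g' : α → ℝ} (h : BddTendsto μ f g) (h' : BddTendsto μ f' g') :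
    BddTendsto μ (fun l t => max (f l t) (f' l t)) (fun t => max (g t) (g' t)) where
  meas l := (h.meas l).sup (h'.meas l)
  bdd := by
    obtain ⟨C, hC⟩ := h.bdd
    obtain ⟨C', hC'⟩ := h'.bdd
    refine ⟨Max.max C C', fun l => ?_⟩
    filter_upwards [hC l, hC' l] with t h1 h2
    exact abs_max_le_max_abs_abs.trans (max_le_max h1 h2)
  lim := by filter_upwards [h.lim, h'.lim] with t h1 h2 using h1.max h2

theorem inner [InnerProductSpace ℝ W] (h : BddTendsto μ f g) (h' : BddTendsto μ f' g') :
    BddTendsto μ (fun l t => inner ℝ (f l t) (f' l t)) (fun t => inner ℝ (g t) (g' t)) where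
  meas l := (h.meas l).inner (h'.meas l)
  bdd := by
    obtain ⟨C, hC⟩ := h.bdd
    obtain ⟨C', hC'⟩ := h'.bdd
    refine ⟨C * C', fun l => ?_⟩
    filter_upwards [hC l, hC' l] with t h1 h2
    exact (norm_inner_le_norm _ _).trans
      (mul_le_mul h1 h2 (norm_nonneg _) ((norm_nonneg _).trans h1))
  lim := by filter_upwards [h.lim, h'.lim] with t h1 h2 using h1.inner h2

theorem indicator (h : BddTendsto μ f g) {A : Set α}
    (hA : MeasurableSet A) : BddTendsto μ (fun l => A.indicator (f l)) (A.indicator g) where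
  meas l := (h.meas l).indicator hA
  bdd := by
    obtain ⟨C, hC⟩ := h.bdd
    exact ⟨C, fun l => (hC l).mono fun t ht => (norm_indicator_le_norm_self _ _).trans ht⟩
  lim := h.lim.mono fun t ht => by
    by_cases hA : t ∈ A
    · simpa [hA] using ht
    · simp [hA]

theorem coord {n : ℕ} {f : ℕ → α → E n} {g : α → E n} (h : BddTendsto μ f g) (i : Fin n) :
    BddTendsto μ (fun l t => f l t i) (fun t => g t i) where
  meas l := (EuclideanSpace.proj (𝕜 := ℝ) i).continuous.comp_aestronglyMeasurable (h.meas l)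
  bdd := by
    obtain ⟨C, hC⟩ := h.bdd
    exact ⟨C, fun l => (hC l).mono fun t ht => (PiLp.norm_apply_le _ i).trans ht⟩
  lim := h.lim.mono fun t ht => ((EuclideanSpace.proj (𝕜 := ℝ) i).continuous.tendsto _).comp ht

theorem tendsto_integral [NormedSpace ℝ W] [IsFiniteMeasure μ] (h : BddTendsto μ f g) :
    Tendsto (fun l => ∫ t, f l t ∂μ) atTop (𝓝 (∫ t, g t ∂μ)) := by
  obtain ⟨C, hC⟩ := h.bdd
  exact tendsto_integral_of_dominated_convergence (fun _ => C) h.meas (integrable_const C) hC h.lim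

end BddTendsto

theorem integrable_of_memLp_top [IsFiniteMeasure μ] {f : α → W} (hf : MemLp f ∞ μ) :
    Integrable f μ := hf.integrable le_top

theorem memLp_top_inner [InnerProductSpace ℝ W] {f g : α → W} (hf : MemLp f ∞ μ)
    (hg : MemLp g ∞ μ) : MemLp (fun t => inner ℝ (f t) (g t)) ∞ μ :=
  ((BddTendsto.const hf).inner (.const hg)).memLp_lim

theorem integrable_inner_of_memLp_top [InnerProductSpace ℝ W] {f g : α → W} (hf : Integrable f μ)
    (hg : MemLp g ∞ μ) : Integrable (fun t => inner ℝ (f t) (g t)) μ := by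
  obtain ⟨C, hC⟩ := exists_ae_norm_le hg
  refine (hf.norm.const_mul C).mono' (hf.1.inner hg.1) ?_
  filter_upwards [hC] with t ht
  rw [mul_comm]
  exact (norm_inner_le_norm _ _).trans (mul_le_mul_of_nonneg_left ht (norm_nonneg _))

theorem memLp_top_coord {n : ℕ} {f : α → E n} (hf : MemLp f ∞ μ) (i : Fin n) :
    MemLp (fun t => f t i) ∞ μ :=
  ((BddTendsto.const hf).coord i).memLp_lim

/-- A sequence converging in `L¹` has an almost everywhere convergent subsequence. -/
theorem exists_subseq_ae_tendsto {f : ℕ → α → W} {g : α → W}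
    (hf : ∀ l, Integrable (f l) μ) (hg : Integrable g μ)
    (h : Tendsto (fun l => ∫ t, ‖f l t - g t‖ ∂μ) atTop (𝓝 0)) :
    ∃ κ : ℕ → ℕ, StrictMono κ ∧ ∀ᵐ t ∂μ, Tendsto (fun l => f (κ l) t) atTop (𝓝 (g t)) := by
  refine (tendstoInMeasure_of_tendsto_eLpNorm (p := 1) one_ne_zero (fun l => (hf l).1) hg.1
    ?_).exists_seq_tendsto_ae
  have h' := ENNReal.tendsto_ofReal h
  rw [ENNReal.ofReal_zero] at h'
  refine h'.congr fun l => ?_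
  rw [eLpNorm_one_eq_lintegral_enorm]
  exact ofReal_integral_norm_eq_lintegral_enorm ((hf l).sub hg)

/-- Weak sequential compactness (along ultrafilters) of bounded sets of `L^∞` in `L²`. -/
theorem exists_weak_limit [IsFiniteMeasure μ] [InnerProductSpace ℝ W] [CompleteSpace W]
    {v : ℕ → α → W} (hv : ∀ l, AEStronglyMeasurable (v l) μ) {C : ℝ}
    (hC : ∀ l, ∀ᵐ t ∂μ, ‖v l t‖ ≤ C) (U : Ultrafilter ℕ) :
    ∃ v₀ : α → W, MemLp v₀ 2 μ ∧ ∀ g : α → W, MemLp g 2 μ →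
      Tendsto (fun l => ∫ t, inner ℝ (v l t) (g t) ∂μ) U (𝓝 (∫ t, inner ℝ (v₀ t) (g t) ∂μ)) := by
  have hm : ∀ l, MemLp (v l) 2 μ := fun l => MemLp.of_bound (hv l) C (hC l)
  let X := Lp W 2 μ
  let V : ℕ → X := fun l => (hm l).toLp
  have hbd : ∃ D : ℝ, ∀ l, ‖V l‖ ≤ D := by
    refine ⟨_, fun l => Lp.norm_le_of_ae_bound (C := max C 0) (le_max_right _ _) ?_⟩
    filter_upwards [hC l, (hm l).coeFn_toLp] with t h1 h2
    rw [h2]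
    exact h1.trans (le_max_left _ _)
  obtain ⟨D, hD⟩ := hbd
  -- The Riesz isometry places the sequence in a ball of the dual of `L²`; Banach–Alaoglu then
  -- provides a limit along `U`, and `v₀` is its Riesz representative.
  let φ : ℕ → WeakDual ℝ X := fun l =>
    StrongDual.toWeakDual (InnerProductSpace.toDual ℝ X (V l))
  have hφ : ∀ l, φ l ∈ WeakDual.toStrongDual ⁻¹' Metric.closedBall (0 : StrongDual ℝ X) D := by
    intro l
    have h : ‖InnerProductSpace.toDual ℝ X (V l)‖ ≤ D := by
      rw [LinearIsometryEquiv.norm_map]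
      exact hD l
    exact (mem_closedBall_zero_iff (E := StrongDual ℝ X)).2 h
  obtain ⟨ψ, -, hψ⟩ := (WeakDual.isCompact_closedBall (𝕜 := ℝ) (E := X) 0 D).ultrafilter_le_nhds
    (U.map φ) (by
      rw [le_principal_iff]
      exact mem_map.2 (univ_mem' hφ))
  let v₀ : X := (InnerProductSpace.toDual ℝ X).symm (WeakDual.toStrongDual ψ)
  refine ⟨v₀, Lp.memLp v₀, fun g hg => ?_⟩
  have h1 : Tendsto (fun l => φ l (hg.toLp g)) U (𝓝 (ψ (hg.toLp g))) :=
    ((WeakDual.eval_continuous (𝕜 := ℝ) (E := X) (hg.toLp g)).tendsto ψ).comp hψ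
  have h2 : ψ (hg.toLp g) = ∫ t, inner ℝ (v₀ t) (g t) ∂μ := by
    have : ψ (hg.toLp g) = inner ℝ v₀ (hg.toLp g) := by
      simp only [v₀, InnerProductSpace.toDual_symm_apply]
      rfl
    rw [this, L2.inner_def]
    refine integral_congr_ae ?_
    filter_upwards [hg.coeFn_toLp] with t ht
    rw [ht]
  have h3 : ∀ l, φ l (hg.toLp g) = ∫ t, inner ℝ (v l t) (g t) ∂μ := by
    intro l
    have : φ l (hg.toLp g) = inner ℝ (V l) (hg.toLp g) := rfl
    rw [this, L2.inner_def]
    refine integral_congr_ae ?_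
    filter_upwards [hg.coeFn_toLp, (hm l).coeFn_toLp] with t ht ht'
    rw [ht, ht']
  rw [← h2]
  exact h1.congr h3

end BoundedConvergence

/-! ### Subdifferentials of functions on inner product spaces -/

section ConvexAnalysis

variable {W : Type*} [NormedAddCommGroup W] [InnerProductSpace ℝ W]

theorem mem_subdiff_of_tendsto {ι : Type*} {l : Filter ι} [l.NeBot] {f : W → ℝ} (hf : Continuous f)
    {x v : ι → W} {x₀ v₀ : W} (hx : Tendsto x l (𝓝 x₀)) (hv : Tendsto v l (𝓝 v₀))
    (h : ∀ i, v i ∈ subdiff f (x i)) : v₀ ∈ subdiff f x₀ := fun y =>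
  le_of_tendsto (((hf.tendsto x₀).comp hx).add (hv.inner (tendsto_const_nhds.sub hx)))
    (Eventually.of_forall fun i => h i y)

/-- Fermat's rule: `x` minimises `f - ⟨v, ·⟩`, so the derivative of this difference vanishes at `x`.
Convexity of `f` plays no role. -/
theorem eq_gradient_of_mem_subdiff [CompleteSpace W] {f : W → ℝ} {x v : W}
    (hf : DifferentiableAt ℝ f x) (hv : v ∈ subdiff f x) : v = gradient f x := by
  have hmin : IsLocalMin (fun y => f y - inner ℝ v y) x := by
    refine Eventually.of_forall fun y => ?_
    have := hv y
    rw [inner_sub_right] at this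
    linarith
  have hd : HasFDerivAt (fun y => f y - inner ℝ v y) (fderiv ℝ f x - innerSL ℝ v) x :=
    hf.hasFDerivAt.sub (innerSL ℝ v).hasFDerivAt
  have h0 := hmin.hasFDerivAt_eq_zero hd
  rw [sub_eq_zero] at h0
  refine ext_inner_right ℝ fun w => ?_
  rw [inner_gradient_left, h0]
  rfl

/-- Subgradients of a continuous function are bounded on compact sets. -/
theorem exists_norm_le_of_mem_subdiff [ProperSpace W] {f : W → ℝ} (hf : Continuous f) (R : ℝ) :
    ∃ C : ℝ, ∀ x v, ‖x‖ ≤ R → v ∈ subdiff f x → ‖v‖ ≤ C := by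
  obtain ⟨C, hC⟩ := (isCompact_closedBall (0 : W) (R + 1)).exists_bound_of_continuousOn
    hf.continuousOn
  refine ⟨C + C, fun x v hx hv => ?_⟩
  have hC0 := hC x (by simp; linarith)
  rcases eq_or_ne v 0 with rfl | hv0
  · rw [norm_zero]
    linarith [(norm_nonneg _).trans hC0]
  have hn : ‖v‖ ≠ 0 := norm_ne_zero_iff.2 hv0
  have hu : ‖‖v‖⁻¹ • v‖ = 1 := by rw [norm_smul, norm_inv, norm_norm, inv_mul_cancel₀ hn]
  -- A unit step in the direction of `v` turns the subgradient inequality into `‖v‖ ≤ f (x + v/‖v‖)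
  -- - f x`. This explains the radius `R + 1` and the bound `C + C`.
  have h1 := hv (x + ‖v‖⁻¹ • v)
  rw [add_sub_cancel_left, inner_smul_right, real_inner_self_eq_norm_sq, sq, ← mul_assoc,
    inv_mul_cancel₀ hn, one_mul] at h1
  have h2 := hC (x + ‖v‖⁻¹ • v) (by
    rw [mem_closedBall_zero_iff]
    exact (norm_add_le _ _).trans (by rw [hu]; linarith))
  rw [Real.norm_eq_abs] at hC0 h2
  linarith [neg_abs_le (f x), le_abs_self (f (x + ‖v‖⁻¹ • v))]

/-- Subgradients of a convex function at points of a convergent sequence converge along an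
ultrafilter to a subgradient at the limit. -/
theorem exists_tendsto_mem_subdiff [FiniteDimensional ℝ W] {f : W → ℝ}
    (hf : ConvexOn ℝ univ f) {x v : ℕ → W} {x₀ : W} (hx : Tendsto x atTop (𝓝 x₀))
    (hv : ∀ l, v l ∈ subdiff f (x l)) (U : Ultrafilter ℕ) (hU : (U : Filter ℕ) ≤ atTop) :
    ∃ v₀ ∈ subdiff f x₀, Tendsto v U (𝓝 v₀) := by
  have : ProperSpace W := FiniteDimensional.proper_real W
  have hc : Continuous f := hf.locallyLipschitz.continuous
  obtain ⟨R, hR⟩ := hx.norm.bddAbove_range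
  obtain ⟨C, hC⟩ := exists_norm_le_of_mem_subdiff hc R
  obtain ⟨v₀, -, hv₀⟩ := (isCompact_closedBall (0 : W) C).ultrafilter_le_nhds (U.map v) (by
    rw [le_principal_iff]
    exact mem_map.2 (univ_mem' fun l =>
      mem_closedBall_zero_iff.2 (hC _ _ (hR ⟨l, rfl⟩) (hv l))))
  exact ⟨v₀, mem_subdiff_of_tendsto hc (hx.mono_left hU) hv₀ hv, hv₀⟩

end ConvexAnalysis

/-! ### Superposition with Carathéodory mappings -/

section Caratheodory

/-- For a simple function in place of `g`, each fibre carries a frozen argument `y`, where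
measurability is assumed. Continuity in `y` makes the composition an almost everywhere limit of such
cases. -/
theorem IsCaratheodory.aestronglyMeasurable_comp {W F : Type*} [TopologicalSpace W]
    [NormedAddCommGroup F] {T : ℝ} {f : W → ℝ → F} (hf : IsCaratheodory T f) {g : ℝ → W}
    (hg : AEStronglyMeasurable g (timeMeasure T)) :
    AEStronglyMeasurable (fun t => f (g t) t) (timeMeasure T) := by
  obtain ⟨g', hg', hgg'⟩ := hg
  have hs : ∀ l, AEStronglyMeasurable (fun t => f (hg'.approx l t) t) (timeMeasure T) := by
    intro l
    set s := hg'.approx l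
    have hcover : ⋃ y : s.range, s ⁻¹' {(y : W)} = univ := by
      ext t
      simp
    rw [← Measure.restrict_univ (μ := timeMeasure T), ← hcover, aestronglyMeasurable_iUnion_iff]
    intro y
    refine ((hf.2 y).mono_measure Measure.restrict_le_self).congr ?_
    filter_upwards [ae_restrict_mem (s.measurableSet_fiber y)] with t ht
    rw [show s t = y from ht]
  refine (aestronglyMeasurable_of_tendsto_ae (f := fun l t => f (hg'.approx l t) t)
    (g := fun t => f (g' t) t) atTop hs ?_).congr ?_
  · filter_upwards [hf.1] with t ht
    exact (ht.tendsto _).comp (hg'.tendsto_approx t)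
  · filter_upwards [hgg'] with t ht
    rw [ht]

variable {n m : ℕ} {T : ℝ}

theorem BddTendsto.caratheodory {W F : Type*} [NormedAddCommGroup W] [NormedAddCommGroup F]
    {f : W → ℝ → F} (hf : IsCaratheodory T f)
    (hb : ∀ R : ℝ, ∃ γ : ℝ, ∀ᵐ t ∂timeMeasure T, ∀ y, ‖y‖ ≤ R → ‖f y t‖ ≤ γ)
    {z : ℕ → ℝ → W} {z₀ : ℝ → W} (hz : BddTendsto (timeMeasure T) z z₀) :
    BddTendsto (timeMeasure T) (fun l t => f (z l t) t) (fun t => f (z₀ t) t) where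
  meas l := hf.aestronglyMeasurable_comp (hz.meas l)
  bdd := by
    obtain ⟨R, hR⟩ := hz.bdd
    obtain ⟨γ, hγ⟩ := hb R
    refine ⟨γ, fun l => ?_⟩
    filter_upwards [hR l, hγ] with t h1 h2 using h2 _ h1
  lim := by
    filter_upwards [hf.1, hz.lim] with t h1 h2 using (h1.tendsto _).comp h2

end Caratheodory

/-! ### Absolutely continuous trajectories and the embedding of `W^{1,1}` into continuous functions
-/

section AbsolutelyContinuous

variable {n : ℕ} {T : ℝ}

instance (T : ℝ) : IsFiniteMeasure (timeMeasure T) := by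
  unfold timeMeasure
  infer_instance

theorem _root_.AbsolutelyContinuousOnInterval.coord {x : ℝ → E n} {a b : ℝ}
    (hx : AbsolutelyContinuousOnInterval x a b) (i : Fin n) :
    AbsolutelyContinuousOnInterval (fun t => x t i) a b := by
  refine squeeze_zero (fun t => Finset.sum_nonneg fun _ _ => dist_nonneg)
    (fun t => Finset.sum_le_sum fun j _ => ?_) hx
  rw [dist_eq_norm, dist_eq_norm]
  exact PiLp.norm_apply_le (x (t.2 j).1 - x (t.2 j).2) i

theorem ae_differentiableAt_of_absolutelyContinuous (hT : 0 ≤ T) {x : ℝ → E n}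
    (hx : AbsolutelyContinuousOnInterval x 0 T) :
    ∀ᵐ t ∂timeMeasure T, DifferentiableAt ℝ x t := by
  unfold timeMeasure
  rw [ae_restrict_iff' measurableSet_Icc]
  filter_upwards [hx.boundedVariationOn.ae_differentiableAt_of_mem_uIcc] with t ht ht'
  exact ht (by rwa [uIcc_of_le hT])

theorem ae_deriv_coord (hT : 0 ≤ T) {x : ℝ → E n}
    (hx : AbsolutelyContinuousOnInterval x 0 T) (i : Fin n) :
    ∀ᵐ t ∂timeMeasure T, deriv (fun t => x t i) t = deriv x t i := by
  filter_upwards [ae_differentiableAt_of_absolutelyContinuous hT hx] with t ht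
  exact ((EuclideanSpace.proj (𝕜 := ℝ) i).hasFDerivAt.comp_hasDerivAt t ht.hasDerivAt).deriv

/-- The fundamental theorem of calculus is applied to each scalar coordinate; the factor `n` comes
from bounding the Euclidean norm by the sum of the coordinates. -/
theorem norm_sub_le_integral_deriv (hT : 0 ≤ T) {x : ℝ → E n}
    (hx : AbsolutelyContinuousOnInterval x 0 T) (hd : Integrable (deriv x) (timeMeasure T))
    {s t : ℝ} (hs : s ∈ Icc 0 T) (ht : t ∈ Icc 0 T) :
    ‖x t - x s‖ ≤ n * ∫ r, ‖deriv x r‖ ∂timeMeasure T := by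
  have key : ∀ i, ‖(x t - x s) i‖ ≤ ∫ r, ‖deriv x r‖ ∂timeMeasure T := by
    intro i
    have hsub : uIcc s t ⊆ Icc 0 T := uIcc_subset_Icc hs ht
    have h1 := (((hx.coord i).mono (by rwa [uIcc_of_le hT] : uIcc s t ⊆ uIcc 0 T))
      ).integral_deriv_eq_sub
    have hsub' : uIoc s t ⊆ Icc 0 T := uIoc_subset_uIcc.trans hsub
    have hae := ae_deriv_coord hT hx i
    rw [PiLp.sub_apply, ← h1]
    refine (intervalIntegral.norm_integral_le_integral_norm_uIoc).trans ?_
    calc ∫ r in uIoc s t, ‖deriv (fun t => x t i) r‖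
        ≤ ∫ r in uIoc s t, ‖deriv x r‖ := by
          refine integral_mono_of_nonneg (ae_of_all _ fun _ => norm_nonneg _)
            (IntegrableOn.mono_set hd.norm hsub') ?_
          filter_upwards [ae_mono (Measure.restrict_mono hsub' le_rfl) hae] with r hr
          rw [hr]
          exact PiLp.norm_apply_le _ i
      _ ≤ ∫ r, ‖deriv x r‖ ∂timeMeasure T :=
          setIntegral_mono_set hd.norm (ae_of_all _ fun _ => norm_nonneg _)
            (LE.le.eventuallyLE hsub')
  calc ‖x t - x s‖ ≤ ∑ i, ‖(x t - x s) i‖ := by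
        rw [EuclideanSpace.norm_eq]
        refine Real.sqrt_le_iff.2 ⟨Finset.sum_nonneg fun _ _ => norm_nonneg _, ?_⟩
        exact Finset.sum_sq_le_sq_sum_of_nonneg fun _ _ => norm_nonneg _
    _ ≤ ∑ _i : Fin n, ∫ r, ‖deriv x r‖ ∂timeMeasure T := Finset.sum_le_sum fun i _ => key i
    _ = n * ∫ r, ‖deriv x r‖ ∂timeMeasure T := by simp

theorem memLp_top_of_absolutelyContinuous (hT : 0 ≤ T) {x : ℝ → E n}
    (hx : AbsolutelyContinuousOnInterval x 0 T) : MemLp x ∞ (timeMeasure T) := by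
  obtain ⟨C, hC⟩ := hx.exists_bound
  have hc := hx.continuousOn
  rw [uIcc_of_le hT] at hc hC
  refine memLp_top_of_bound (hc.aestronglyMeasurable measurableSet_Icc) C ?_
  filter_upwards [ae_restrict_mem measurableSet_Icc] with t ht using hC t ht

/-- The embedding of `W^{1,1}` into the space of continuous functions. -/
theorem norm_le_of_absolutelyContinuous (hT : 0 < T) {x : ℝ → E n}
    (hx : AbsolutelyContinuousOnInterval x 0 T) (hd : Integrable (deriv x) (timeMeasure T))
    {t : ℝ} (ht : t ∈ Icc 0 T) :
    ‖x t‖ ≤ T⁻¹ * (∫ r, ‖x r‖ ∂timeMeasure T) + n * ∫ r, ‖deriv x r‖ ∂timeMeasure T := by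
  set B := n * ∫ r, ‖deriv x r‖ ∂timeMeasure T with hB
  have hxi : Integrable x (timeMeasure T) :=
    integrable_of_memLp_top (memLp_top_of_absolutelyContinuous hT.le hx)
  -- `‖x t‖ - B ≤ ‖x r‖` holds for every `r` in `[0, T]`; integrating over `r` gives a bound free of
  -- any pointwise value of `x`.
  have h1 : ∫ _r, (‖x t‖ - B) ∂timeMeasure T ≤ ∫ r, ‖x r‖ ∂timeMeasure T := by
    refine integral_mono_ae (integrable_const _) hxi.norm ?_
    filter_upwards [ae_restrict_mem (μ := volume) (s := Icc 0 T) measurableSet_Icc] with r hr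
    have := norm_sub_le_integral_deriv hT.le hx hd hr ht
    have h2 := norm_sub_norm_le (x t) (x r)
    linarith
  have hvol : (timeMeasure T).real univ = T := by
    simp [timeMeasure, Measure.real, hT.le]
  rw [integral_const, hvol, smul_eq_mul] at h1
  have h3 : ‖x t‖ - B ≤ T⁻¹ * ∫ r, ‖x r‖ ∂timeMeasure T := by
    rw [inv_mul_eq_div, le_div_iff₀ hT]
    linarith
  linarith

end AbsolutelyContinuous


/-! ### Weak limits of subgradients -/

section WeakLimits

variable {α W : Type*} [MeasurableSpace α] {μ : Measure α} [IsFiniteMeasure μ]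
  [NormedAddCommGroup W] [InnerProductSpace ℝ W]

/-- Weak convergence, tested along bounded sequences that converge almost everywhere. -/
def WeakTendsto (μ : Measure α) (U : Filter ℕ) (v : ℕ → α → W) (v₀ : α → W) : Prop :=
  ∀ (g : ℕ → α → W) (g₀ : α → W), BddTendsto μ g g₀ →
    Tendsto (fun l => ∫ t, inner ℝ (v l t) (g l t) ∂μ) U (𝓝 (∫ t, inner ℝ (v₀ t) (g₀ t) ∂μ))

/-- Moving the test function from `g₀` to `g l` costs at most `C ∫ ‖g l - g₀‖`, which vanishes by
dominated convergence; the test against the fixed `g₀` is ordinary weak convergence. -/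
theorem exists_weakTendsto [CompleteSpace W]
    {v : ℕ → α → W} (hv : ∀ l, AEStronglyMeasurable (v l) μ) {C : ℝ}
    (hC : ∀ l, ∀ᵐ t ∂μ, ‖v l t‖ ≤ C) (U : Ultrafilter ℕ) (hU : (U : Filter ℕ) ≤ atTop) :
    ∃ v₀ : α → W, MemLp v₀ 2 μ ∧ WeakTendsto μ U v v₀ := by
  obtain ⟨v₀, hv₀, h⟩ := exists_weak_limit hv hC U
  refine ⟨v₀, hv₀, fun g g₀ hg => ?_⟩
  have hvm : ∀ l, MemLp (v l) ∞ μ := fun l => memLp_top_of_bound (hv l) C (hC l)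
  have hg₀ : MemLp g₀ ∞ μ := hg.memLp_lim
  have h1 := h g₀ (hg₀.mono_exponent le_top)
  have hd := hg.sub (.const hg₀)
  have h2 : Tendsto (fun l => ∫ t, inner ℝ (v l t) (g l t - g₀ t) ∂μ) U (𝓝 0) := by
    have h3 := (hd.norm.tendsto_integral.const_mul C).mono_left hU
    simp only [sub_self, norm_zero, integral_zero, mul_zero] at h3
    refine squeeze_zero_norm (fun l => ?_) h3
    rw [← integral_const_mul]
    refine norm_integral_le_of_norm_le ((integrable_of_memLp_top (hd.norm.memLp l)).const_mul C) ?_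
    filter_upwards [hC l] with t ht
    exact (norm_inner_le_norm _ _).trans (mul_le_mul_of_nonneg_right ht (norm_nonneg _))
  have h4 := h1.add h2
  rw [add_zero] at h4
  refine h4.congr fun l => ?_
  rw [← integral_add (integrable_of_memLp_top (memLp_top_inner (hvm l) hg₀))
    (integrable_of_memLp_top (memLp_top_inner (hvm l) (hd.memLp l)))]
  refine integral_congr_ae (ae_of_all _ fun t => ?_)
  simp only
  rw [← inner_add_right, add_sub_cancel]

/-- The subdifferential of a convex integrand is closed under strong convergence of points and
weak convergence of subgradients. -/
theorem ae_mem_subdiff_of_weakTendsto [CompleteSpace W] [TopologicalSpace.SeparableSpace W]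
    {T : ℝ} {f : W → ℝ → ℝ} (hf : IsCaratheodory T f)
    (hb : ∀ R : ℝ, ∃ γ : ℝ, ∀ᵐ t ∂timeMeasure T, ∀ y, ‖y‖ ≤ R → ‖f y t‖ ≤ γ)
    {y v : ℕ → ℝ → W} {y₀ v₀ : ℝ → W} (hy : BddTendsto (timeMeasure T) y y₀)
    (hvm : ∀ l, MemLp (v l) ∞ (timeMeasure T))
    {U : Filter ℕ} [U.NeBot] (hU : U ≤ atTop) (hv₀ : MemLp v₀ 2 (timeMeasure T))
    (hw : WeakTendsto (timeMeasure T) U v v₀)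
    (hmem : ∀ l, ∀ᵐ t ∂timeMeasure T, v l t ∈ subdiff (fun x => f x t) (y l t)) :
    ∀ᵐ t ∂timeMeasure T, v₀ t ∈ subdiff (fun x => f x t) (y₀ t) := by
  set μ := timeMeasure T
  obtain ⟨D, hDc, hDd⟩ := TopologicalSpace.exists_countable_dense W
  have hyf := hy.caratheodory hf hb
  have hpt : ∀ x : W, ∀ᵐ t ∂μ, f (y₀ t) t + inner ℝ (v₀ t) (x - y₀ t) ≤ f x t := by
    intro x
    have hx : BddTendsto μ (fun _ _ => x) (fun _ => x) := .const (memLp_const x)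
    have hxf := hx.caratheodory hf hb
    have hd := hx.sub hy
    have hin : Integrable (fun t => inner ℝ (v₀ t) (x - y₀ t)) μ :=
      integrable_inner_of_memLp_top (hv₀.integrable one_le_two) hd.memLp_lim
    have hi0 := integrable_of_memLp_top hyf.memLp_lim
    -- For fixed `x` the subgradient inequality is integrated over an arbitrary measurable set `A`.
    -- In this form it survives the weak limit, with test functions `1_A (x - y l)`, and `A` being
    -- arbitrary gives back the pointwise inequality.
    refine ae_le_of_forall_setIntegral_le (hi0.add hin) (integrable_of_memLp_top hxf.memLp_lim)
      fun A hA _ => ?_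
    have h1 := (hyf.indicator hA).tendsto_integral.mono_left hU
    have h2 := hw _ _ (hd.indicator hA)
    have h3 : ∀ l, ∫ t, A.indicator (fun t => f (y l t) t) t ∂μ
        + ∫ t, inner ℝ (v l t) (A.indicator (fun t => x - y l t) t) ∂μ
        ≤ ∫ t, A.indicator (fun t => f x t) t ∂μ := by
      intro l
      have hi1 := integrable_of_memLp_top ((hyf.indicator hA).memLp l)
      have hi2 := integrable_of_memLp_top (memLp_top_inner (hvm l) ((hd.indicator hA).memLp l))
      rw [← integral_add hi1 hi2]
      refine integral_mono_ae (hi1.add hi2)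
        (integrable_of_memLp_top (hxf.indicator hA).memLp_lim) ?_
      filter_upwards [hmem l] with t ht
      by_cases htA : t ∈ A
      · simpa [htA] using ht x
      · simp [htA]
    have h4 := le_of_tendsto (h1.add h2) (Eventually.of_forall h3)
    have h5 : ∫ t, inner ℝ (v₀ t) (A.indicator (fun t => x - y₀ t) t) ∂μ
        = ∫ t in A, inner ℝ (v₀ t) (x - y₀ t) ∂μ := by
      rw [← integral_indicator hA]
      refine integral_congr_ae (ae_of_all _ fun t => ?_)
      by_cases htA : t ∈ A <;> simp [htA]
    rw [h5, integral_indicator hA, integral_indicator hA,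
      ← integral_add hi0.integrableOn hin.integrableOn] at h4
    exact h4
  -- The exceptional null set depends on `x`, so only countably many `x` are admitted here;
  -- continuity in `x` and density of `D` supply the rest.
  have hall : ∀ᵐ t ∂μ, ∀ x ∈ D, f (y₀ t) t + inner ℝ (v₀ t) (x - y₀ t) ≤ f x t :=
    (ae_ball_iff hDc).2 fun x _ => hpt x
  filter_upwards [hall, hf.1] with t ht hc x
  have hcl : IsClosed {x | f (y₀ t) t + inner ℝ (v₀ t) (x - y₀ t) ≤ f x t} :=
    isClosed_le (by fun_prop) hc
  exact hcl.closure_subset_iff.2 ht (hDd x)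

end WeakLimits

/-! ### Consequences of convergence in `Y` -/

section Spaces

variable {n m : ℕ} {T : ℝ}

theorem norm_pt_le (z : StateControl n m) (t : ℝ) : ‖pt z t‖ ≤ ‖z.1 t‖ + ‖z.2 t‖ := by
  rw [WithLp.prod_norm_eq_of_L2]
  refine Real.sqrt_le_iff.2 ⟨by positivity, ?_⟩
  change ‖z.1 t‖ ^ 2 + ‖z.2 t‖ ^ 2 ≤ _
  nlinarith [mul_nonneg (norm_nonneg (z.1 t)) (norm_nonneg (z.2 t))]

theorem norm_fst_add_norm_snd_le (y : E2 n m) : ‖y.fst‖ + ‖y.snd‖ ≤ 2 * ‖y‖ := by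
  have h1 : ‖y.fst‖ ≤ ‖y‖ := by
    rw [WithLp.prod_norm_eq_of_L2]
    exact Real.le_sqrt_of_sq_le (by nlinarith [sq_nonneg ‖y.snd‖])
  have h2 : ‖y.snd‖ ≤ ‖y‖ := by
    rw [WithLp.prod_norm_eq_of_L2]
    exact Real.le_sqrt_of_sq_le (by nlinarith [sq_nonneg ‖y.fst‖])
  linarith

theorem BddTendsto.pt {z : ℕ → StateControl n m} {zs : StateControl n m} {μ : Measure ℝ}
    (hx : BddTendsto μ (fun l => (z l).1) zs.1) (hu : BddTendsto μ (fun l => (z l).2) zs.2) :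
    BddTendsto μ (fun l => pt (z l)) (pt zs) where
  meas l := (WithLp.prod_continuous_toLp 2 (E n) (E m)).comp_aestronglyMeasurable
    ((hx.meas l).prodMk (hu.meas l))
  bdd := by
    obtain ⟨C, hC⟩ := hx.bdd
    obtain ⟨C', hC'⟩ := hu.bdd
    refine ⟨C + C', fun l => ?_⟩
    filter_upwards [hC l, hC' l] with t h1 h2
    exact (norm_pt_le _ _).trans (add_le_add h1 h2)
  lim := by
    filter_upwards [hx.lim, hu.lim] with t h1 h2
    exact ((WithLp.prod_continuous_toLp 2 (E n) (E m)).tendsto _).comp (h1.prodMk_nhds h2)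

theorem memLp_pt (hT : 0 ≤ T) {z : StateControl n m} (hz : z ∈ spaceX n m T) :
    MemLp (pt z) ∞ (timeMeasure T) :=
  (BddTendsto.pt (z := fun _ => z)
    (.const (memLp_top_of_absolutelyContinuous hT hz.1.1)) (.const hz.2)).memLp_lim

theorem ae_deriv_sub (hT : 0 ≤ T) {x x' : ℝ → E n} (hx : AbsolutelyContinuousOnInterval x 0 T)
    (hx' : AbsolutelyContinuousOnInterval x' 0 T) :
    deriv (x - x') =ᵐ[timeMeasure T] fun t => deriv x t - deriv x' t := by
  filter_upwards [ae_differentiableAt_of_absolutelyContinuous hT hx,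
    ae_differentiableAt_of_absolutelyContinuous hT hx'] with t h1 h2
  exact deriv_sub h1 h2

/-- Convergence in `Y` of a sequence with uniformly bounded controls implies, along a subsequence,
bounded almost everywhere convergence, convergence of the end-points, and convergence in `L¹` of
the derivatives. -/
theorem exists_subseq_bddTendsto (hT : 0 < T) {z : ℕ → StateControl n m}
    {zs : StateControl n m} (hz : ∀ l, z l ∈ spaceX n m T) (hzs : zs ∈ spaceX n m T)
    {R : ℝ} (hu : ∀ l, ∀ᵐ t ∂timeMeasure T, ‖(z l).2 t‖ ≤ R)
    (hlim : Tendsto (fun l => normY T (z l - zs)) atTop (𝓝 0)) :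
    ∃ κ : ℕ → ℕ, StrictMono κ ∧
      BddTendsto (timeMeasure T) (fun l => pt (z (κ l))) (pt zs) ∧
      Tendsto (fun l => ends T (z (κ l))) atTop (𝓝 (ends T zs)) ∧
      Tendsto (fun l => ∫ t, ‖deriv (z (κ l)).1 t - deriv zs.1 t‖ ∂timeMeasure T) atTop
        (𝓝 0) := by
  set μ := timeMeasure T
  have hderiv : ∀ l, deriv (z l - zs).1 =ᵐ[μ] fun t => deriv (z l).1 t - deriv zs.1 t :=
    fun l => ae_deriv_sub hT.le (hz l).1.1 hzs.1.1
  have hdint : ∀ l, Integrable (deriv (z l - zs).1) μ := fun l =>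
    ((integrable_of_memLp_top (hz l).1.2).sub (integrable_of_memLp_top hzs.1.2)).congr
      (hderiv l).symm
  have hn1 : ∀ l, 0 ≤ ∫ t, ‖(z l - zs).1 t‖ ∂μ := fun l => integral_nonneg fun _ => norm_nonneg _
  have hn2 : ∀ l, 0 ≤ ∫ t, ‖deriv (z l - zs).1 t‖ ∂μ := fun l =>
    integral_nonneg fun _ => norm_nonneg _
  have hn3 : ∀ l, 0 ≤ ∫ t, ‖(z l - zs).2 t‖ ∂μ := fun l => integral_nonneg fun _ => norm_nonneg _
  have hnY : ∀ l, normY T (z l - zs) = (∫ t, ‖(z l - zs).1 t‖ ∂μ)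
    + (∫ t, ‖deriv (z l - zs).1 t‖ ∂μ) + ∫ t, ‖(z l - zs).2 t‖ ∂μ := fun _ => rfl
  have hTi : 0 < T⁻¹ := inv_pos.2 hT
  -- The embedding makes the states converge uniformly along the whole sequence. A subsequence is
  -- needed only for the controls.
  have hsup : ∀ l, ∀ t ∈ Icc 0 T,
      ‖(z l).1 t - zs.1 t‖ ≤ (T⁻¹ + n) * normY T (z l - zs) := by
    intro l t ht
    refine (norm_le_of_absolutelyContinuous hT ((hz l).1.1.sub hzs.1.1) (hdint l) ht).trans ?_
    have h1 := mul_le_mul_of_nonneg_left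
      (show ∫ t, ‖(z l - zs).1 t‖ ∂μ ≤ normY T (z l - zs) by
        rw [hnY]; linarith [hn2 l, hn3 l]) hTi.le
    have h2 := mul_le_mul_of_nonneg_left
      (show ∫ t, ‖deriv (z l - zs).1 t‖ ∂μ ≤ normY T (z l - zs) by
        rw [hnY]; linarith [hn1 l, hn3 l]) (Nat.cast_nonneg (α := ℝ) n)
    rw [add_mul]
    exact add_le_add h1 h2
  have hsup0 : Tendsto (fun l => (T⁻¹ + n) * normY T (z l - zs)) atTop (𝓝 0) := by
    simpa using hlim.const_mul (T⁻¹ + (n : ℝ))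
  have hxlim : ∀ t ∈ Icc 0 T, Tendsto (fun l => (z l).1 t) atTop (𝓝 (zs.1 t)) := fun t ht =>
    tendsto_iff_norm_sub_tendsto_zero.2
      (squeeze_zero (fun _ => norm_nonneg _) (fun l => hsup l t ht) hsup0)
  have hTae : ∀ᵐ t ∂μ, t ∈ Icc 0 T := ae_restrict_mem measurableSet_Icc
  have hx : BddTendsto μ (fun l => (z l).1) zs.1 := by
    refine ⟨fun l => (memLp_top_of_absolutelyContinuous hT.le (hz l).1.1).1, ?_,
      hTae.mono hxlim⟩
    obtain ⟨B, hB⟩ := hsup0.bddAbove_range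
    obtain ⟨C, hC⟩ := hzs.1.1.exists_bound
    rw [uIcc_of_le hT.le] at hC
    refine ⟨C + B, fun l => ?_⟩
    filter_upwards [hTae] with t ht
    calc ‖(z l).1 t‖ = ‖zs.1 t + ((z l).1 t - zs.1 t)‖ := by rw [add_sub_cancel]
      _ ≤ C + B := (norm_add_le _ _).trans
        (add_le_add (hC t ht) ((hsup l t ht).trans (hB ⟨l, rfl⟩)))
  obtain ⟨κ, hκ, hae⟩ := exists_subseq_ae_tendsto (f := fun l => (z l).2) (g := zs.2) (μ := μ)
    (fun l => integrable_of_memLp_top (hz l).2) (integrable_of_memLp_top hzs.2)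
    (squeeze_zero (fun l => hn3 l) (fun l => by
      rw [hnY]
      exact le_add_of_nonneg_left (add_nonneg (hn1 l) (hn2 l))) hlim)
  have hκ' := hκ.tendsto_atTop
  refine ⟨κ, hκ, (hx.comp_subseq hκ').pt ⟨fun l => (hz _).2.1, ⟨R, fun l => hu _⟩, hae⟩, ?_, ?_⟩
  · exact ((WithLp.prod_continuous_toLp 2 (E n) (E n)).tendsto _).comp
      (((hxlim 0 (left_mem_Icc.2 hT.le)).prodMk_nhds (hxlim T (right_mem_Icc.2 hT.le))).comp hκ')
  · refine Tendsto.comp (g := fun l => ∫ t, ‖deriv (z l).1 t - deriv zs.1 t‖ ∂μ) ?_ hκ'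
    refine squeeze_zero (fun l => integral_nonneg fun _ => norm_nonneg _) (fun l => ?_) hlim
    have h : ∫ t, ‖deriv (z l - zs).1 t‖ ∂μ = ∫ t, ‖deriv (z l).1 t - deriv zs.1 t‖ ∂μ :=
      integral_congr_ae ((hderiv l).fun_comp norm)
    rw [hnY, ← h]
    exact (le_add_of_nonneg_left (hn1 l)).trans (le_add_of_nonneg_right (hn3 l))

end Spaces


/-- Pointwise form of `φ ≤ Γ` for the dynamics: `a` and `b` are the linearised increments of `G_i`
and `H_i`, and each sign of the residual has its concave part replaced by an affine majorant. -/
theorem abs_sub_sub_le_max {d gz gy hz hy a b : ℝ} (ha : gz + a ≤ gy) (hb : hz + b ≤ hy) :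
    |d - (gy - hy)| ≤ max (d + hy - gz - a) (-d + gy - hz - b) := by
  rw [abs_le']
  constructor
  · exact le_max_of_le_left (by linarith)
  · exact le_max_of_le_right (by linarith)

/-- Convergence of points together with the subgradients entering the integral terms of the
convexified infeasibility measure. -/
structure SubgradTendsto {n m ℓI ℓE ℓM : ℕ} (T : ℝ) (z : ℕ → StateControl n m)
    (V : ℕ → SubgradCollection n m ℓI ℓE ℓM) (zs : StateControl n m)
    (Vs : SubgradCollection n m ℓI ℓE ℓM) : Prop where
  points : BddTendsto (timeMeasure T) (fun l => pt (z l)) (pt zs)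
  gradH : ∀ i, BddTendsto (timeMeasure T) (fun l => (V l).V i) (Vs.V i)
  gradG : ∀ i, BddTendsto (timeMeasure T) (fun l => (V l).W i) (Vs.W i)
  gradq : ∀ s, BddTendsto (timeMeasure T) (fun l => (V l).zq s) (Vs.zq s)

/-! ### Bounds and convergence for the data, the subgradients and the integral terms -/

namespace DCProblem

variable {n m ℓI ℓE ℓM : ℕ} {P : DCProblem n m ℓI ℓE ℓM}

namespace Standing

theorem exists_growth_bound (hP : P.Standing) (R : ℝ) :
    ∃ γ : ℝ, ∀ᵐ t ∂timeMeasure P.T, ∀ y : E2 n m, ‖y‖ ≤ R →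
      |P.G0 y t| ≤ γ ∧ |P.H0 y t| ≤ γ ∧ ‖P.G y t‖ ≤ γ ∧ ‖P.H y t‖ ≤ γ ∧
        ∀ s, |P.p s y t| ≤ γ ∧ |P.q s y t| ≤ γ := by
  -- The growth condition measures `|x| + |u|`, which is at most twice the Euclidean norm; `|R|` and
  -- the extra `1` provide the required positive radius for every real `R`.
  obtain ⟨γ, -, h⟩ := hP.growth (2 * |R| + 1) (by positivity)
  exact ⟨γ, h.mono fun t ht y hy =>
    ht y (by linarith [norm_fst_add_norm_snd_le y, le_abs_self R])⟩

theorem exists_subdiff_bound (hP : P.Standing) (R : ℝ) :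
    ∃ γ : ℝ, ∀ᵐ t ∂timeMeasure P.T, ∀ y : E2 n m, ‖y‖ ≤ R →
      (∀ v ∈ subdiff (fun y => P.H0 y t) y, ‖v‖ ≤ γ) ∧
      (∀ i, (∀ v ∈ subdiff (fun y => P.H y t i) y, ‖v‖ ≤ γ) ∧
        ∀ v ∈ subdiff (fun y => P.G y t i) y, ‖v‖ ≤ γ) ∧
      (∀ s, ∀ v ∈ subdiff (fun y => P.q s y t) y, ‖v‖ ≤ γ) := by
  obtain ⟨γ, -, h⟩ := hP.subdiff_bound (2 * |R| + 1) (by positivity)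
  refine ⟨γ, h.mono fun t ht y hy => ?_⟩
  obtain ⟨h1, h2, h3⟩ := ht y (by linarith [norm_fst_add_norm_snd_le y, le_abs_self R])
  exact ⟨fun v hv => h1 v (.inr hv),
    fun i => ⟨fun v hv => h2 i v (.inr hv), fun v hv => h2 i v (.inl hv)⟩,
    fun s v hv => h3 s v (.inr hv)⟩

variable {y : ℕ → ℝ → E2 n m} {y₀ : ℝ → E2 n m}

theorem H0_bound (hP : P.Standing) (R : ℝ) :
    ∃ γ : ℝ, ∀ᵐ t ∂timeMeasure P.T, ∀ y, ‖y‖ ≤ R → ‖P.H0 y t‖ ≤ γ :=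
  let ⟨γ, h⟩ := hP.exists_growth_bound R
  ⟨γ, h.mono fun _ ht y hy => (ht y hy).2.1⟩

theorem bddTendsto_G0 (hP : P.Standing) (hy : BddTendsto (timeMeasure P.T) y y₀) :
    BddTendsto (timeMeasure P.T) (fun l t => P.G0 (y l t) t) (fun t => P.G0 (y₀ t) t) :=
  hy.caratheodory hP.G0_carath fun R =>
    let ⟨γ, h⟩ := hP.exists_growth_bound R
    ⟨γ, h.mono fun _ ht y hy => (ht y hy).1⟩

theorem bddTendsto_H0 (hP : P.Standing) (hy : BddTendsto (timeMeasure P.T) y y₀) :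
    BddTendsto (timeMeasure P.T) (fun l t => P.H0 (y l t) t) (fun t => P.H0 (y₀ t) t) :=
  hy.caratheodory hP.H0_carath hP.H0_bound

theorem bddTendsto_G (hP : P.Standing) (hy : BddTendsto (timeMeasure P.T) y y₀) (i : Fin n) :
    BddTendsto (timeMeasure P.T) (fun l t => P.G (y l t) t i) (fun t => P.G (y₀ t) t i) :=
  (hy.caratheodory hP.G_carath fun R =>
    let ⟨γ, h⟩ := hP.exists_growth_bound R
    ⟨γ, h.mono fun _ ht y hy => (ht y hy).2.2.1⟩).coord i

theorem bddTendsto_H (hP : P.Standing) (hy : BddTendsto (timeMeasure P.T) y y₀) (i : Fin n) :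
    BddTendsto (timeMeasure P.T) (fun l t => P.H (y l t) t i) (fun t => P.H (y₀ t) t i) :=
  (hy.caratheodory hP.H_carath fun R =>
    let ⟨γ, h⟩ := hP.exists_growth_bound R
    ⟨γ, h.mono fun _ ht y hy => (ht y hy).2.2.2.1⟩).coord i

theorem bddTendsto_p (hP : P.Standing) (hy : BddTendsto (timeMeasure P.T) y y₀) (s : Fin ℓM) :
    BddTendsto (timeMeasure P.T) (fun l t => P.p s (y l t) t) (fun t => P.p s (y₀ t) t) :=
  hy.caratheodory (hP.p_carath s) fun R =>
    let ⟨γ, h⟩ := hP.exists_growth_bound R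
    ⟨γ, h.mono fun _ ht y hy => ((ht y hy).2.2.2.2 s).1⟩

theorem bddTendsto_q (hP : P.Standing) (hy : BddTendsto (timeMeasure P.T) y y₀) (s : Fin ℓM) :
    BddTendsto (timeMeasure P.T) (fun l t => P.q s (y l t) t) (fun t => P.q s (y₀ t) t) :=
  hy.caratheodory (hP.q_carath s) fun R =>
    let ⟨γ, h⟩ := hP.exists_growth_bound R
    ⟨γ, h.mono fun _ ht y hy => ((ht y hy).2.2.2.2 s).2⟩

end Standing

/-- Subgradients along a bounded sequence are uniformly bounded. -/
theorem exists_subgrad_bound (hP : P.Standing) {z : ℕ → StateControl n m} {zs : StateControl n m}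
    (hz : BddTendsto (timeMeasure P.T) (fun l => pt (z l)) (pt zs))
    {V : ℕ → SubgradCollection n m ℓI ℓE ℓM} (hV : ∀ l, P.IsSubgrad (z l) (V l)) :
    ∃ γ : ℝ, (∀ l, ∀ᵐ t ∂timeMeasure P.T, ‖(V l).V0 t‖ ≤ γ) ∧
      (∀ i l, ∀ᵐ t ∂timeMeasure P.T, ‖(V l).V i t‖ ≤ γ) ∧
      (∀ i l, ∀ᵐ t ∂timeMeasure P.T, ‖(V l).W i t‖ ≤ γ) ∧
      (∀ s l, ∀ᵐ t ∂timeMeasure P.T, ‖(V l).zq s t‖ ≤ γ) := by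
  obtain ⟨R, hR⟩ := hz.bdd
  obtain ⟨γ, hγ⟩ := hP.exists_subdiff_bound R
  refine ⟨γ, fun l => ?_, fun i l => ?_, fun i l => ?_, fun s l => ?_⟩
  · filter_upwards [hR l, hγ, (hV l).V0_mem] with t h1 h2 h3 using (h2 _ h1).1 _ h3
  · filter_upwards [hR l, hγ, (hV l).V_mem i] with t h1 h2 h3 using ((h2 _ h1).2.1 i).1 _ h3
  · filter_upwards [hR l, hγ, (hV l).W_mem i] with t h1 h2 h3 using ((h2 _ h1).2.1 i).2 _ h3
  · filter_upwards [hR l, hγ, (hV l).zq_mem s] with t h1 h2 h3 using (h2 _ h1).2.2 s _ h3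

theorem IsSubgrad.memLp_V0 (hP : P.Standing) {zs : StateControl n m} (hzs : zs ∈ spaceX n m P.T)
    {V : SubgradCollection n m ℓI ℓE ℓM} (hV : P.IsSubgrad zs V) :
    MemLp V.V0 ∞ (timeMeasure P.T) :=
  let ⟨γ, h, _⟩ := exists_subgrad_bound hP (.const (memLp_pt hP.T_pos.le hzs)) fun _ => hV
  memLp_top_of_bound hV.V0_meas γ (h 0)

/-- Viewing one point as a constant sequence lets the convergence lemmas below also serve as
integrability statements. -/
theorem IsSubgrad.tendsto_const (hP : P.Standing) {zs : StateControl n m}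
    (hzs : zs ∈ spaceX n m P.T) {V : SubgradCollection n m ℓI ℓE ℓM} (hV : P.IsSubgrad zs V) :
    SubgradTendsto P.T (fun _ => zs) (fun _ => V) zs V := by
  have hpt := BddTendsto.const (memLp_pt hP.T_pos.le hzs)
  obtain ⟨γ, -, h1, h2, h3⟩ := exists_subgrad_bound hP hpt fun _ => hV
  exact ⟨hpt, fun i => .const (memLp_top_of_bound (hV.V_meas i) γ (h1 i 0)),
    fun i => .const (memLp_top_of_bound (hV.W_meas i) γ (h2 i 0)),
    fun s => .const (memLp_top_of_bound (hV.zq_meas s) γ (h3 s 0))⟩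

/-- Under the smoothness assumptions the subgradients of the smooth parts converge. -/
theorem SmoothParts.subgradTendsto (hsm : P.SmoothParts) (hP : P.Standing)
    {z : ℕ → StateControl n m} {zs : StateControl n m}
    (hz : BddTendsto (timeMeasure P.T) (fun l => pt (z l)) (pt zs))
    {V : ℕ → SubgradCollection n m ℓI ℓE ℓM} (hV : ∀ l, P.IsSubgrad (z l) (V l))
    {Vs : SubgradCollection n m ℓI ℓE ℓM}
    (h1 : Vs.V = fun i t => gradient (fun y => P.H y t i) (pt zs t))
    (h2 : Vs.W = fun i t => gradient (fun y => P.G y t i) (pt zs t))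
    (h3 : Vs.zq = fun s t => gradient (fun y => P.q s y t) (pt zs t)) :
    SubgradTendsto P.T z V zs Vs := by
  obtain ⟨γ, -, b1, b2, b3⟩ := exists_subgrad_bound hP hz hV
  refine ⟨hz, fun i => ⟨fun l => (hV l).V_meas i, ⟨γ, b1 i⟩, ?_⟩,
    fun i => ⟨fun l => (hV l).W_meas i, ⟨γ, b2 i⟩, ?_⟩,
    fun s => ⟨fun l => (hV l).zq_meas s, ⟨γ, b3 s⟩, ?_⟩⟩
  -- At almost every `t` the gradient is the only possible subgradient, and its continuity in `y`
  -- carries over the convergence of the points.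
  · filter_upwards [hz.lim, hsm.H_diff i, (hsm.H_grad i).1,
      ae_all_iff.2 fun l => (hV l).V_mem i] with t ht hd hc hm
    rw [h1]
    exact ((hc.tendsto _).comp ht).congr fun l => (eq_gradient_of_mem_subdiff (hd _) (hm l)).symm
  · filter_upwards [hz.lim, hsm.G_diff i, (hsm.G_grad i).1,
      ae_all_iff.2 fun l => (hV l).W_mem i] with t ht hd hc hm
    rw [h2]
    exact ((hc.tendsto _).comp ht).congr fun l => (eq_gradient_of_mem_subdiff (hd _) (hm l)).symm
  · filter_upwards [hz.lim, hsm.q_diff s, (hsm.q_grad s).1,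
      ae_all_iff.2 fun l => (hV l).zq_mem s] with t ht hd hc hm
    rw [h3]
    exact ((hc.tendsto _).comp ht).congr fun l => (eq_gradient_of_mem_subdiff (hd _) (hm l)).symm

section IntegralTerms

variable {z : ℕ → StateControl n m} {zs : StateControl n m}
  {V : ℕ → SubgradCollection n m ℓI ℓE ℓM} {Vs : SubgradCollection n m ℓI ℓE ℓM}
  {w : StateControl n m}

theorem bddTendsto_dynamics (hP : P.Standing) (h : SubgradTendsto P.T z V zs Vs)
    (hw : w ∈ spaceX n m P.T) (i : Fin n) :
    BddTendsto (timeMeasure P.T)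
      (fun l t => max
        (deriv w.1 t i + P.H (pt w t) t i - P.G (pt (z l) t) t i
          - inner ℝ ((V l).W i t) (pt w t - pt (z l) t))
        (-deriv w.1 t i + P.G (pt w t) t i - P.H (pt (z l) t) t i
          - inner ℝ ((V l).V i t) (pt w t - pt (z l) t)))
      (fun t => max
        (deriv w.1 t i + P.H (pt w t) t i - P.G (pt zs t) t i
          - inner ℝ (Vs.W i t) (pt w t - pt zs t))
        (-deriv w.1 t i + P.G (pt w t) t i - P.H (pt zs t) t i
          - inner ℝ (Vs.V i t) (pt w t - pt zs t))) := by
  have hwc := BddTendsto.const (memLp_pt hP.T_pos.le hw)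
  have hd := BddTendsto.const (memLp_top_coord hw.1.2 i)
  have hdiff := hwc.sub h.points
  exact (((hd.add (hP.bddTendsto_H hwc i)).sub (hP.bddTendsto_G h.points i)).sub
      ((h.gradG i).inner hdiff)).max
    (((hd.neg.add (hP.bddTendsto_G hwc i)).sub (hP.bddTendsto_H h.points i)).sub
      ((h.gradH i).inner hdiff))

theorem bddTendsto_mixed (hP : P.Standing) (h : SubgradTendsto P.T z V zs Vs)
    (hw : w ∈ spaceX n m P.T) (s : Fin ℓM) :
    BddTendsto (timeMeasure P.T)
      (fun l t => max 0 (P.p s (pt w t) t - P.q s (pt (z l) t) t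
        - inner ℝ ((V l).zq s t) (pt w t - pt (z l) t)))
      (fun t => max 0 (P.p s (pt w t) t - P.q s (pt zs t) t
        - inner ℝ (Vs.zq s t) (pt w t - pt zs t))) := by
  have hwc := BddTendsto.const (memLp_pt hP.T_pos.le hw)
  have h0 : BddTendsto (timeMeasure P.T) (fun (_ : ℕ) (_ : ℝ) => (0 : ℝ)) (fun _ => 0) :=
    .const (memLp_const 0)
  exact h0.max (((hP.bddTendsto_p hwc s).sub (hP.bddTendsto_q h.points s)).sub
    ((h.gradq s).inner (hwc.sub h.points)))

theorem memLp_dynamics (hP : P.Standing) (hw : w ∈ spaceX n m P.T) (i : Fin n) :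
    MemLp (fun t => deriv w.1 t i - (P.G (pt w t) t i - P.H (pt w t) t i)) ∞
      (timeMeasure P.T) := by
  have hwc := BddTendsto.const (memLp_pt hP.T_pos.le hw)
  exact ((BddTendsto.const (memLp_top_coord hw.1.2 i)).sub
    ((hP.bddTendsto_G hwc i).sub (hP.bddTendsto_H hwc i))).memLp_lim

theorem bddTendsto_mixed_phi (hP : P.Standing)
    (hz : BddTendsto (timeMeasure P.T) (fun l => pt (z l)) (pt zs)) (s : Fin ℓM) :
    BddTendsto (timeMeasure P.T)
      (fun l t => max 0 (P.p s (pt (z l) t) t - P.q s (pt (z l) t) t))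
      (fun t => max 0 (P.p s (pt zs t) t - P.q s (pt zs t) t)) := by
  have h0 : BddTendsto (timeMeasure P.T) (fun (_ : ℕ) (_ : ℝ) => (0 : ℝ)) (fun _ => 0) :=
    .const (memLp_const 0)
  exact h0.max ((hP.bddTendsto_p hz s).sub (hP.bddTendsto_q hz s))

end IntegralTerms

theorem phi_nonneg (w : StateControl n m) : 0 ≤ P.phi w := by
  unfold phi
  have h1 : 0 ≤ ∑ i, ∫ t, |deriv w.1 t i - (P.G (pt w t) t i - P.H (pt w t) t i)|
      ∂timeMeasure P.T :=
    Finset.sum_nonneg fun i _ => integral_nonneg fun _ => abs_nonneg _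
  have h2 : 0 ≤ ∑ s, ∫ t, max 0 (P.p s (pt w t) t - P.q s (pt w t) t) ∂timeMeasure P.T :=
    Finset.sum_nonneg fun i _ => integral_nonneg fun _ => le_max_left _ _
  have h3 : 0 ≤ ∑ i, max 0 (P.gI i (ends P.T w) - P.hI i (ends P.T w)) :=
    Finset.sum_nonneg fun i _ => le_max_left _ _
  have h4 : 0 ≤ ∑ j, |P.gE j (ends P.T w) - P.hE j (ends P.T w)| :=
    Finset.sum_nonneg fun i _ => abs_nonneg _
  linarith

theorem phi_eq_zero_of_isFeasible {zs : StateControl n m} (h : P.IsFeasible zs) :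
    P.phi zs = 0 := by
  unfold phi
  have h1 : ∀ i, ∫ t, |deriv zs.1 t i - (P.G (pt zs t) t i - P.H (pt zs t) t i)|
      ∂timeMeasure P.T = 0 := fun i => by
    refine integral_eq_zero_of_ae ?_
    filter_upwards [h.dynamics] with t ht
    simp [ht]
  have h2 : ∀ s, ∫ t, max 0 (P.p s (pt zs t) t - P.q s (pt zs t) t) ∂timeMeasure P.T = 0 :=
    fun s => by
      refine integral_eq_zero_of_ae ?_
      filter_upwards [h.mixed s] with t ht
      exact max_eq_left ht
  have h3 : ∀ i, max 0 (P.gI i (ends P.T zs) - P.hI i (ends P.T zs)) = 0 :=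
    fun i => max_eq_left (h.ineq i)
  have h4 : ∀ j, |P.gE j (ends P.T zs) - P.hE j (ends P.T zs)| = 0 :=
    fun j => abs_eq_zero.2 (h.eq j)
  simp [h1, h2, h3, h4]

/-! ### The convexified functionals as global majorants -/

section Majorants

variable {zs w : StateControl n m} {V : SubgradCollection n m ℓI ℓE ℓM}

/-- At the base point the convexified infeasibility measure is the penalty term. -/
theorem Gam_self (zs : StateControl n m) (V : SubgradCollection n m ℓI ℓE ℓM) :
    P.Gam zs V zs = P.phi zs := by
  have hmax : ∀ d g h : ℝ, max (d + h - g) (-d + g - h) = |d - (g - h)| := fun d g h => by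
    rw [abs_eq_max_neg]
    congr 1 <;> ring
  have hmax' : ∀ g h : ℝ, max (g - h) (h - g) = |g - h| := fun g h => by
    rw [abs_eq_max_neg, neg_sub]
  simp only [Gam, phi, sub_self, inner_zero_right, sub_zero, hmax, hmax']

/-- The convexified infeasibility measure majorises the penalty term. -/
theorem phi_le_Gam (hP : P.Standing) (hzs : zs ∈ spaceX n m P.T) (hV : P.IsSubgrad zs V)
    (hw : w ∈ spaceX n m P.T) : P.phi w ≤ P.Gam zs V w := by
  have hc := hV.tendsto_const hP hzs
  unfold phi Gam
  refine add_le_add (add_le_add (add_le_add ?_ ?_) ?_) ?_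
  · refine Finset.sum_le_sum fun i _ => integral_mono_ae
      (integrable_of_memLp_top (memLp_dynamics hP hw i)).abs
      (integrable_of_memLp_top (bddTendsto_dynamics hP hc hw i).memLp_lim) ?_
    filter_upwards [hV.V_mem i, hV.W_mem i] with t h1 h2
    exact abs_sub_sub_le_max (h2 _) (h1 _)
  · refine Finset.sum_le_sum fun i _ => max_le_max le_rfl ?_
    linarith [hV.vI_mem i (ends P.T w)]
  · refine Finset.sum_le_sum fun j _ => abs_le'.2 ⟨le_max_of_le_left ?_, le_max_of_le_right ?_⟩
    · linarith [hV.vE_mem j (ends P.T w)]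
    · linarith [hV.wE_mem j (ends P.T w)]
  · refine Finset.sum_le_sum fun s _ => integral_mono_ae
      (integrable_of_memLp_top
        (bddTendsto_mixed_phi hP (.const (memLp_pt hP.T_pos.le hw)) s).memLp_lim)
      (integrable_of_memLp_top (bddTendsto_mixed hP hc hw s).memLp_lim) ?_
    filter_upwards [hV.zq_mem s] with t h1
    exact max_le_max le_rfl (by linarith [h1 (pt w t)])

/-- `J` and `ω` share the convex parts `G₀` and `g₀`; only the concave parts differ, and there the
subgradient inequalities for `H₀` and `h₀` apply. -/
theorem J_sub_le_omega_sub (hP : P.Standing) (hzs : zs ∈ spaceX n m P.T)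
    (hV : P.IsSubgrad zs V) (hw : w ∈ spaceX n m P.T) :
    P.J w - P.J zs ≤ P.omega V w - P.omega V zs := by
  have hwc := BddTendsto.const (memLp_pt hP.T_pos.le hw)
  have hzc := BddTendsto.const (memLp_pt hP.T_pos.le hzs)
  have hVc := BddTendsto.const (hV.memLp_V0 hP hzs)
  have i1 := integrable_of_memLp_top ((hP.bddTendsto_G0 hwc).sub (hP.bddTendsto_H0 hwc)).memLp_lim
  have i2 := integrable_of_memLp_top ((hP.bddTendsto_G0 hzc).sub (hP.bddTendsto_H0 hzc)).memLp_lim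
  have i3 := integrable_of_memLp_top ((hP.bddTendsto_G0 hwc).sub (hVc.inner hwc)).memLp_lim
  have i4 := integrable_of_memLp_top ((hP.bddTendsto_G0 hzc).sub (hVc.inner hzc)).memLp_lim
  have hint := integral_mono_ae (i1.sub i2) (i3.sub i4) (by
    filter_upwards [hV.V0_mem] with t ht
    have := ht (pt w t)
    rw [inner_sub_right] at this
    simp only [Pi.sub_apply]
    linarith)
  rw [integral_sub' i1 i2, integral_sub' i3 i4] at hint
  have hend := hV.v0_mem (ends P.T w)
  rw [inner_sub_right] at hend
  unfold J omega
  linarith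

theorem Phi_sub_le_Q_sub (hP : P.Standing) (hzs : zs ∈ spaceX n m P.T)
    (hV : P.IsSubgrad zs V) (hw : w ∈ spaceX n m P.T) {c : ℝ} (hc : 0 ≤ c) :
    P.Phi c w - P.Phi c zs ≤ P.Q c zs V w - P.Q c zs V zs := by
  have h1 := J_sub_le_omega_sub hP hzs hV hw
  have h2 := mul_le_mul_of_nonneg_left (phi_le_Gam hP hzs hV hw) hc
  unfold Phi Q
  rw [Gam_self]
  linarith

end Majorants

/-! ### Passage to the limit in the penalty term and the majorants -/

section Limits

variable {z : ℕ → StateControl n m} {zs : StateControl n m}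
  {V : ℕ → SubgradCollection n m ℓI ℓE ℓM} {Vs : SubgradCollection n m ℓI ℓE ℓM}
  {U : Filter ℕ}

theorem tendsto_Gam (hP : P.Standing) (hU : U ≤ atTop) (h : SubgradTendsto P.T z V zs Vs)
    (he : Tendsto (fun l => ends P.T (z l)) atTop (𝓝 (ends P.T zs)))
    (hvI : ∀ i, Tendsto (fun l => (V l).vI i) U (𝓝 (Vs.vI i)))
    (hvE : ∀ j, Tendsto (fun l => (V l).vE j) U (𝓝 (Vs.vE j)))
    (hwE : ∀ j, Tendsto (fun l => (V l).wE j) U (𝓝 (Vs.wE j)))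
    {w : StateControl n m} (hw : w ∈ spaceX n m P.T) :
    Tendsto (fun l => P.Gam (z l) (V l) w) U (𝓝 (P.Gam zs Vs w)) := by
  have heU := he.mono_left hU
  have hcont : ∀ {f : E2 n n → ℝ}, ConvexOn ℝ univ f →
      Tendsto (fun l => f (ends P.T (z l))) U (𝓝 (f (ends P.T zs))) := fun hf =>
    (hf.locallyLipschitz.continuous.tendsto _).comp heU
  have hdiff := (tendsto_const_nhds (x := ends P.T w)).sub heU
  unfold Gam
  refine ((Tendsto.add ?_ ?_).add ?_).add ?_
  · exact tendsto_finsetSum _ fun i _ =>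
      (bddTendsto_dynamics hP h hw i).tendsto_integral.mono_left hU
  · exact tendsto_finsetSum _ fun i _ => tendsto_const_nhds.max
      ((tendsto_const_nhds.sub (hcont (hP.hI_convex i))).sub ((hvI i).inner hdiff))
  · exact tendsto_finsetSum _ fun j _ =>
      ((tendsto_const_nhds.sub (hcont (hP.hE_convex j))).sub ((hvE j).inner hdiff)).max
      ((tendsto_const_nhds.sub (hcont (hP.gE_convex j))).sub ((hwE j).inner hdiff))
  · exact tendsto_finsetSum _ fun s _ =>
      (bddTendsto_mixed hP h hw s).tendsto_integral.mono_left hU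

/-- The derivatives converge only in `L¹`, with no uniform bound, so the dynamics term is compared
through `||a| - |b|| ≤ |a - b|`; the other integrals use bounded convergence. -/
theorem tendsto_phi (hP : P.Standing) (hzX : ∀ l, z l ∈ spaceX n m P.T)
    (hzs : zs ∈ spaceX n m P.T)
    (hz : BddTendsto (timeMeasure P.T) (fun l => pt (z l)) (pt zs))
    (he : Tendsto (fun l => ends P.T (z l)) atTop (𝓝 (ends P.T zs)))
    (hd : Tendsto (fun l => ∫ t, ‖deriv (z l).1 t - deriv zs.1 t‖ ∂timeMeasure P.T) atTop
      (𝓝 0)) :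
    Tendsto (fun l => P.phi (z l)) atTop (𝓝 (P.phi zs)) := by
  have hcont : ∀ {f : E2 n n → ℝ}, ConvexOn ℝ univ f →
      Tendsto (fun l => f (ends P.T (z l))) atTop (𝓝 (f (ends P.T zs))) := fun hf =>
    (hf.locallyLipschitz.continuous.tendsto _).comp he
  unfold phi
  refine ((Tendsto.add ?_ ?_).add ?_).add ?_
  · refine tendsto_finsetSum _ fun i _ => ?_
    set μ := timeMeasure P.T
    let F : StateControl n m → ℝ → ℝ := fun w t => P.G (pt w t) t i - P.H (pt w t) t i
    have hF : BddTendsto μ (fun l => F (z l)) (F zs) :=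
      (hP.bddTendsto_G hz i).sub (hP.bddTendsto_H hz i)
    have hFd := (hF.sub (.const hF.memLp_lim)).norm
    have hF0 := hFd.tendsto_integral
    simp only [sub_self, norm_zero, integral_zero] at hF0
    have hi : ∀ l, Integrable (fun t => |deriv (z l).1 t i - F (z l) t|) μ := fun l =>
      (integrable_of_memLp_top (memLp_dynamics hP (hzX l) i)).abs
    have hi0 : Integrable (fun t => |deriv zs.1 t i - F zs t|) μ :=
      (integrable_of_memLp_top (memLp_dynamics hP hzs i)).abs
    have hid : ∀ l, Integrable (fun t => ‖deriv (z l).1 t - deriv zs.1 t‖) μ := fun l =>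
      ((integrable_of_memLp_top (hzX l).1.2).sub (integrable_of_memLp_top hzs.1.2)).norm
    rw [tendsto_iff_norm_sub_tendsto_zero]
    have hsum := hd.add hF0
    rw [add_zero] at hsum
    refine squeeze_zero (fun _ => norm_nonneg _) (fun l => ?_) hsum
    have hFi := integrable_of_memLp_top (hFd.memLp l)
    change ‖∫ t, |deriv (z l).1 t i - F (z l) t| ∂μ - ∫ t, |deriv zs.1 t i - F zs t| ∂μ‖ ≤ _
    rw [← integral_sub (hi l) hi0, ← integral_add (hid l) hFi]
    refine norm_integral_le_of_norm_le ((hid l).add hFi) (ae_of_all _ fun t => ?_)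
    have h1 : |deriv (z l).1 t i - deriv zs.1 t i| ≤ ‖deriv (z l).1 t - deriv zs.1 t‖ :=
      PiLp.norm_apply_le (deriv (z l).1 t - deriv zs.1 t) i
    refine (abs_abs_sub_abs_le_abs_sub _ _).trans ?_
    calc |deriv (z l).1 t i - F (z l) t - (deriv zs.1 t i - F zs t)|
        = |(deriv (z l).1 t i - deriv zs.1 t i) - (F (z l) t - F zs t)| := by
          congr 1; ring
      _ ≤ |deriv (z l).1 t i - deriv zs.1 t i| + |F (z l) t - F zs t| := abs_sub _ _
      _ ≤ _ := add_le_add h1 le_rfl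
  · exact tendsto_finsetSum _ fun i _ => tendsto_const_nhds.max
      ((hcont (hP.gI_convex i)).sub (hcont (hP.hI_convex i)))
  · exact tendsto_finsetSum _ fun j _ =>
      ((hcont (hP.gE_convex j)).sub (hcont (hP.hE_convex j))).abs
  · exact tendsto_finsetSum _ fun s _ => (bddTendsto_mixed_phi hP hz s).tendsto_integral

/-- `V₀` occurs linearly, so weak convergence suffices even with a moving argument `w l`. Both the
iterates themselves and a fixed competitor are covered. -/
theorem tendsto_omega (hP : P.Standing) (hU : U ≤ atTop)
    (hV0 : ∀ l, MemLp (V l).V0 ∞ (timeMeasure P.T)) (hVs : MemLp Vs.V0 2 (timeMeasure P.T))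
    (hweak : WeakTendsto (timeMeasure P.T) U (fun l => (V l).V0) Vs.V0)
    (hv0 : Tendsto (fun l => (V l).v0) U (𝓝 Vs.v0))
    {w : ℕ → StateControl n m} {w₀ : StateControl n m}
    (hw : BddTendsto (timeMeasure P.T) (fun l => pt (w l)) (pt w₀))
    (he : Tendsto (fun l => ends P.T (w l)) atTop (𝓝 (ends P.T w₀))) :
    Tendsto (fun l => P.omega (V l) (w l)) U (𝓝 (P.omega Vs w₀)) := by
  have heU := he.mono_left hU
  have hG := hP.bddTendsto_G0 hw
  unfold omega
  rw [integral_sub (integrable_of_memLp_top hG.memLp_lim)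
    (integrable_inner_of_memLp_top (hVs.integrable one_le_two) hw.memLp_lim)]
  refine Tendsto.add ?_
    (((hP.g0_convex.locallyLipschitz.continuous.tendsto _).comp heU).sub (hv0.inner heU))
  refine ((hG.tendsto_integral.mono_left hU).sub (hweak _ _ hw)).congr fun l => ?_
  rw [integral_sub (integrable_of_memLp_top (hG.memLp l))
    (integrable_of_memLp_top (memLp_top_inner (hV0 l) (hw.memLp l)))]

end Limits

end DCProblem


theorem ae_mem_subdiff_of_tendsto {W : Type*} [NormedAddCommGroup W] [InnerProductSpace ℝ W]
    {T : ℝ} {f : ℝ → W → ℝ} {y v : ℕ → ℝ → W}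
    {y₀ v₀ : ℝ → W} (hf : ∀ᵐ t ∂timeMeasure T, Continuous (f t))
    (hy : BddTendsto (timeMeasure T) y y₀) (hv : BddTendsto (timeMeasure T) v v₀)
    (hm : ∀ l, ∀ᵐ t ∂timeMeasure T, v l t ∈ subdiff (f t) (y l t)) :
    ∀ᵐ t ∂timeMeasure T, v₀ t ∈ subdiff (f t) (y₀ t) := by
  filter_upwards [hf, hv.lim, hy.lim, ae_all_iff.2 hm] with t h1 h2 h3 h4
  exact mem_subdiff_of_tendsto h1 h3 h2 h4

theorem continuous_coord {W : Type*} [TopologicalSpace W] {n : ℕ} {T : ℝ} {f : W → ℝ → E n}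
    (hf : ∀ᵐ t ∂timeMeasure T, Continuous fun y => f y t) (i : Fin n) :
    ∀ᵐ t ∂timeMeasure T, Continuous fun y => f y t i :=
  hf.mono fun _ ht => (EuclideanSpace.proj (𝕜 := ℝ) i).continuous.comp ht

/-! ### Closedness of generalised criticality, and the feasible case -/

namespace DCProblem

variable {n m ℓI ℓE ℓM : ℕ} {P : DCProblem n m ℓI ℓE ℓM}

/-- Closedness of generalised criticality: limits of points that are asymptotically `ε`-optimal for
their own convexified problems are generalised `ε`-critical. -/
theorem isGenEpsCritical_of_tendsto (hP : P.Standing) (hsm : P.SmoothParts)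
    {z : ℕ → StateControl n m} {zs : StateControl n m}
    {V : ℕ → SubgradCollection n m ℓI ℓE ℓM} (hzX : ∀ l, z l ∈ spaceX n m P.T)
    (hzs : zs ∈ P.X0) (hV : ∀ l, P.IsSubgrad (z l) (V l))
    (hz : BddTendsto (timeMeasure P.T) (fun l => pt (z l)) (pt zs))
    (he : Tendsto (fun l => ends P.T (z l)) atTop (𝓝 (ends P.T zs)))
    (hd : Tendsto (fun l => ∫ t, ‖deriv (z l).1 t - deriv zs.1 t‖ ∂timeMeasure P.T) atTop
      (𝓝 0))
    {c ε : ℝ} (hopt : ∀ w ∈ P.X0, ∀ η > 0, ∀ᶠ l in atTop,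
      P.Q c (z l) (V l) (z l) ≤ P.Q c (z l) (V l) w + ε + η) :
    P.IsGenEpsCritical c ε zs := by
  have hzsX := hP.X0_subset hzs
  -- Along one ultrafilter finer than `atTop` all the compactness limits exist at once, without
  -- successive extraction of subsequences.
  let U : Ultrafilter ℕ := Ultrafilter.of atTop
  have hU : (U : Filter ℕ) ≤ atTop := Ultrafilter.of_le atTop
  obtain ⟨γ, hγ, -⟩ := exists_subgrad_bound hP hz hV
  have hV0 : ∀ l, MemLp (V l).V0 ∞ (timeMeasure P.T) := fun l =>
    memLp_top_of_bound (hV l).V0_meas γ (hγ l)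
  obtain ⟨V0, hV0s, hweak⟩ := exists_weakTendsto (fun l => (hV l).V0_meas) hγ U hU
  obtain ⟨v0, hv0m, hv0⟩ :=
    exists_tendsto_mem_subdiff hP.h0_convex he (fun l => (hV l).v0_mem) U hU
  choose vI hvIm hvI using fun i =>
    exists_tendsto_mem_subdiff (hP.hI_convex i) he (fun l => (hV l).vI_mem i) U hU
  choose vE hvEm hvE using fun j =>
    exists_tendsto_mem_subdiff (hP.hE_convex j) he (fun l => (hV l).vE_mem j) U hU
  choose wE hwEm hwE using fun j =>
    exists_tendsto_mem_subdiff (hP.gE_convex j) he (fun l => (hV l).wE_mem j) U hU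
  let Vs : SubgradCollection n m ℓI ℓE ℓM :=
    { V0 := V0
      V := fun i t => gradient (fun y => P.H y t i) (pt zs t)
      W := fun i t => gradient (fun y => P.G y t i) (pt zs t)
      zq := fun s t => gradient (fun y => P.q s y t) (pt zs t)
      v0 := v0
      vI := vI
      vE := vE
      wE := wE }
  have hST : SubgradTendsto P.T z V zs Vs := hsm.subgradTendsto hP hz hV rfl rfl rfl
  have hsub : P.IsSubgrad zs Vs :=
    { V0_meas := hV0s.1
      V_meas := fun i => (hST.gradH i).memLp_lim.1
      W_meas := fun i => (hST.gradG i).memLp_lim.1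
      zq_meas := fun s => (hST.gradq s).memLp_lim.1
      V0_mem := ae_mem_subdiff_of_weakTendsto hP.H0_carath hP.H0_bound hz hV0 hU hV0s hweak
        fun l => (hV l).V0_mem
      V_mem := fun i => ae_mem_subdiff_of_tendsto (continuous_coord hP.H_carath.1 i) hz (hST.gradH i)
        fun l => (hV l).V_mem i
      W_mem := fun i => ae_mem_subdiff_of_tendsto (continuous_coord hP.G_carath.1 i) hz (hST.gradG i)
        fun l => (hV l).W_mem i
      zq_mem := fun s => ae_mem_subdiff_of_tendsto (hP.q_carath s).1 hz (hST.gradq s)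
        fun l => (hV l).zq_mem s
      v0_mem := hv0m
      vI_mem := hvIm
      vE_mem := hvEm
      wE_mem := hwEm }
  refine ⟨hzs, Vs, hsub, hzs, fun w hw => le_of_forall_pos_le_add fun η hη => ?_⟩
  have hwX := hP.X0_subset hw
  -- At its own base point `Γ` equals `φ`, so the side with the moving argument needs only the
  -- limits of `ω` and `φ`.
  have hleft : Tendsto (fun l => P.Q c (z l) (V l) (z l)) U (𝓝 (P.Q c zs Vs zs)) := by
    unfold Q
    simp only [Gam_self]
    exact (tendsto_omega hP hU hV0 hV0s hweak hv0 hz he).add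
      (((tendsto_phi hP hzX hzsX hz he hd).mono_left hU).const_mul c)
  have hright : Tendsto (fun l => P.Q c (z l) (V l) w) U (𝓝 (P.Q c zs Vs w)) := by
    have hwc : BddTendsto (timeMeasure P.T) (fun _ => pt w) (pt w) :=
      .const (memLp_pt hP.T_pos.le hwX)
    have hec : Tendsto (fun _ : ℕ => ends P.T w) atTop (𝓝 (ends P.T w)) := tendsto_const_nhds
    have h1 := tendsto_omega (V := V) (Vs := Vs) (w := fun _ => w) hP hU hV0 hV0s hweak hv0 hwc hec
    exact h1.add ((tendsto_Gam hP hU hST he hvI hvE hwE hwX).const_mul c)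
  exact le_of_tendsto_of_tendsto hleft ((hright.add_const ε).add_const η)
    ((hopt w hw η hη).filter_mono hU)

/-- By feasibility `Γ` is zero at `zs`, while `Γ ≥ φ ≥ 0` on `X₀`: a larger `c` leaves the value at
`zs` unchanged and can only raise the competitors. The same `V` works for all `c' ≥ c`. -/
theorem IsGenEpsCritical.isEpsCritical (hP : P.Standing) {c ε : ℝ} (hc : 0 < c)
    {zs : StateControl n m} (h : P.IsGenEpsCritical c ε zs) (hf : P.IsFeasible zs) :
    P.IsEpsCritical ε zs := by
  obtain ⟨hzs, V, hV, -, hopt⟩ := h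
  refine ⟨hf, V, hV, c, hc, fun c' hc' => ⟨hzs, fun w hw => ?_⟩⟩
  have h0 : P.Gam zs V zs = 0 := by rw [Gam_self, phi_eq_zero_of_isFeasible hf]
  have h1 : 0 ≤ P.Gam zs V w :=
    (phi_nonneg w).trans (phi_le_Gam hP (hP.X0_subset hzs) hV (hP.X0_subset hw))
  have h2 := hopt w hw
  have h3 := mul_le_mul_of_nonneg_right hc' h1
  unfold Q at h2 ⊢
  rw [h0] at h2 ⊢
  linarith

end DCProblem

/-! ### Stabilisation of the penalty parameter and vanishing decrease -/

namespace Run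

variable {n m ℓI ℓE ℓM : ℕ} {P : DCProblem n m ℓI ℓE ℓM} {A : Run P}

theorem z_mem (htrial : A.TrialStepsAdmissible) (k : ℕ) : A.z k ∈ P.X0 := by
  cases k with
  | zero => exact A.z_zero_mem
  | succ k => rw [A.z_succ]; exact htrial k _

/-- If the penalty parameters are bounded, they are eventually never increased. -/
theorem exists_penalty_const (hincr : A.UniformIncrease) (hc : BddAbove (range A.c)) :
    ∃ K, A.c 0 ≤ A.c K ∧ ∀ k ≥ K, A.N k = 0 ∧ A.c k = A.c K := by
  obtain ⟨ϰ, hϰ, h⟩ := hincr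
  have hstep : ∀ k r, r ≤ A.N k → A.c k + r * ϰ ≤ A.cTry k r := by
    intro k r
    induction r with
    | zero => intro _; simp [A.cTry_zero]
    | succ r ih =>
      intro hr
      have h1 := ih (by omega)
      have h2 := h k r (by omega)
      push_cast
      linarith
  have hsucc : ∀ k, A.c k + A.N k * ϰ ≤ A.c (k + 1) := fun k => by
    rw [A.c_succ]; exact hstep k _ le_rfl
  have hmono : Monotone A.c := monotone_nat_of_le_succ fun k => by
    have := hsucc k
    have : 0 ≤ (A.N k : ℝ) * ϰ := by positivity
    linarith
  -- A bounded monotone sequence has consecutive differences tending to zero, whereas an iteration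
  -- with `N k ≥ 1` changes `c` by at least `ϰ`.
  have hlim := tendsto_atTop_ciSup hmono hc
  have hdiff := (hlim.comp (tendsto_add_atTop_nat 1)).sub hlim
  rw [sub_self] at hdiff
  obtain ⟨K, hK⟩ := eventually_atTop.1 (hdiff.eventually_lt_const hϰ)
  have hN : ∀ k ≥ K, A.N k = 0 := by
    intro k hk
    by_contra hne
    have h1 : (1 : ℝ) ≤ A.N k := by exact_mod_cast Nat.one_le_iff_ne_zero.2 hne
    have h2 := hsucc k
    have h3 : A.c (k + 1) - A.c k < ϰ := hK k hk
    nlinarith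
  refine ⟨K, hmono (Nat.zero_le K), fun k hk => ⟨hN k hk, ?_⟩⟩
  induction k, hk using Nat.le_induction with
  | base => rfl
  | succ k hk ih => rw [A.c_succ, hN k hk, A.cTry_zero, ih]

/-- Once the penalty parameter is constant, the decrease of the convexified penalty function
achieved by the convex subproblems vanishes. -/
theorem tendsto_decrease (hP : P.Standing) (hworse : A.NoWorse) (htrial : A.TrialStepsAdmissible)
    (hbelow : BddBelow (P.Phi (A.c 0) '' P.X0)) (hν : Summable A.ν) {K : ℕ}
    (hcK : A.c 0 ≤ A.c K) (hK : ∀ k ≥ K, A.N k = 0 ∧ A.c k = A.c K) :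
    Tendsto (fun k => P.Q (A.c K) (A.z k) (A.V k) (A.z k)
      - P.Q (A.c K) (A.z k) (A.V k) (A.zTry k 0)) atTop (𝓝 0) := by
  have hc0 : 0 ≤ A.c K := A.c_zero_pos.le.trans hcK
  obtain ⟨B, hB⟩ := hbelow
  have hlow : ∀ k, B ≤ P.Phi (A.c K) (A.z k) := fun k => by
    have h1 := hB (mem_image_of_mem _ (z_mem htrial k))
    have h2 := mul_le_mul_of_nonneg_right hcK (DCProblem.phi_nonneg (P := P) (A.z k))
    unfold DCProblem.Phi at h1 ⊢
    linarith
  have hctry : ∀ k ≥ K, A.cTry k 0 = A.c K := fun k hk => by rw [A.cTry_zero, (hK k hk).2]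
  set δ : ℕ → ℝ := fun k => P.Q (A.c K) (A.z k) (A.V k) (A.z k)
      - P.Q (A.c K) (A.z k) (A.V k) (A.zTry k 0) with hδ
  have hδ0 : ∀ k ≥ K, 0 ≤ δ k := fun k hk => by
    have h := hworse k 0 (Nat.zero_le _)
    rw [hctry k hk] at h
    simp only [hδ]
    linarith
  -- The majorant bounds the change of `Φ` from `z k` to the trial point; the line search then adds
  -- at most `ν k`, its quadratic term being dropped by sign.
  have hdesc : ∀ k ≥ K, δ k ≤ P.Phi (A.c K) (A.z k) - P.Phi (A.c K) (A.z (k + 1)) + A.ν k := by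
    intro k hk
    have hN := (hK k hk).1
    have h1 := (A.step5 k).2.1
    rw [hN, (hK (k + 1) (by omega)).2] at h1
    have hz := A.z_succ k
    rw [hN] at hz
    rw [← hz] at h1
    have hzt : A.zTry k 0 ∈ P.X0 := (A.zTry_opt k 0 (Nat.zero_le _)).1
    have h2 := DCProblem.Phi_sub_le_Q_sub hP (hP.X0_subset (z_mem htrial k)) (A.V_subgrad k)
      (hP.X0_subset hzt) hc0
    have h3 : 0 ≤ A.σ * (A.ζ ^ A.j k * A.αbar k) ^ 2 * norm2 P.T (A.zTry k 0 - A.z k) ^ 2 :=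
      mul_nonneg (mul_nonneg A.hσ.1.le (sq_nonneg _)) (sq_nonneg _)
    simp only [hδ]
    linarith
  rw [← tendsto_add_atTop_iff_nat K]
  refine (summable_of_sum_range_le (c := P.Phi (A.c K) (A.z K) - B + ∑' k, A.ν k)
    (fun k => hδ0 _ (Nat.le_add_left _ _)) fun N => ?_).tendsto_atTop_zero
  -- Telescoping from index `K` on; the last value of `Φ` is bounded below by `B`, and positivity of
  -- `ν` bounds its shifted partial sums by the full series.
  have hpart : ∀ N, ∑ k ∈ Finset.range N, δ (k + K)
      ≤ P.Phi (A.c K) (A.z K) - P.Phi (A.c K) (A.z (N + K))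
        + ∑ k ∈ Finset.range N, A.ν (k + K) := by
    intro N
    induction N with
    | zero => simp
    | succ N ih =>
      rw [Finset.sum_range_succ, Finset.sum_range_succ]
      have h := hdesc (N + K) (Nat.le_add_left _ _)
      rw [show N + 1 + K = N + K + 1 by omega]
      linarith
  have hsumν : ∑ k ∈ Finset.range N, A.ν (k + K) ≤ ∑' k, A.ν k := by
    rw [← Finset.sum_image (f := A.ν) (g := fun k => k + K) fun _ _ _ _ h => by simpa using h]
    exact hν.sum_le_tsum _ fun k _ => (A.hν k).le
  linarith [hpart N, hlow (N + K)]

end Run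

end BStepDCA

end

/-! ### The convergence theorem -/

theorem mainTheorem1 {n m ℓI ℓE ℓM : ℕ} (P : BStepDCA.DCProblem n m ℓI ℓE ℓM)
    (hP : P.Standing) (A : BStepDCA.Run P)
    -- standing assumptions on the method
    (hworse : A.NoWorse) (htrial : A.TrialStepsAdmissible) (hincr : A.UniformIncrease)
    (hbelow : BddBelow (P.Phi (A.c 0) '' P.X0))
    -- assumptions of the theorem
    (hc : BddAbove (Set.range A.c)) (hε : BddAbove (Set.range A.ε))
    (hν : Summable A.ν)
    (εs : ℝ) (hεs : Filter.limsup A.ε Filter.atTop = εs)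
    (hu : ∃ R : ℝ, ∀ k, ∀ᵐ t ∂BStepDCA.timeMeasure P.T, ‖(A.z k).2 t‖ ≤ R)
    (hsmooth : P.SmoothParts)
    -- the limit point
    (zs : BStepDCA.StateControl n m) (hzs : zs ∈ BStepDCA.spaceX n m P.T)
    (hlim : BStepDCA.IsLimitPointInY P.T A.z zs) :
    (∃ cs : ℝ, 0 < cs ∧ (∀ᶠ k in Filter.atTop, A.c k = cs) ∧ P.IsGenEpsCritical cs εs zs) ∧
      (P.IsFeasible zs → P.IsEpsCritical εs zs) := by
  obtain ⟨K, hcK, hK⟩ := A.exists_penalty_const hincr hc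
  have hcpos : 0 < A.c K := A.c_zero_pos.trans_le hcK
  have hX : ∀ k, A.z k ∈ BStepDCA.spaceX n m P.T := fun k =>
    hP.X0_subset (BStepDCA.Run.z_mem htrial k)
  obtain ⟨κ, hκ, hconv⟩ := hlim
  have hzs0 : zs ∈ P.X0 := by
    refine hP.X0_closed zs hzs fun δ hδ => ?_
    obtain ⟨l, hl⟩ := (hconv.eventually_lt_const hδ).exists
    exact ⟨_, BStepDCA.Run.z_mem htrial _, hl⟩
  obtain ⟨R, hR⟩ := hu
  obtain ⟨κ', hκ', hz, he, hd⟩ := BStepDCA.exists_subseq_bddTendsto hP.T_pos (fun l => hX (κ l)) hzs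
    (fun l => hR (κ l)) hconv
  have hsub : Tendsto (fun l => κ (κ' l)) atTop atTop := (hκ.comp hκ').tendsto_atTop
  have hdec := BStepDCA.Run.tendsto_decrease hP hworse htrial hbelow hν hcK hK
  have hcrit : P.IsGenEpsCritical (A.c K) εs zs := by
    refine BStepDCA.DCProblem.isGenEpsCritical_of_tendsto hP hsmooth (fun l => hX _) hzs0
      (fun l => A.V_subgrad (κ (κ' l))) hz he hd fun w hw η hη => ?_
    -- One half of `η` absorbs the excess of `ε k` over its limsup, the other the vanishing decrease
    -- of the subproblem.
    have hη2 : 0 < η / 2 := half_pos hη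
    have h1 : ∀ᶠ k in atTop, A.ε k < εs + η / 2 :=
      eventually_lt_of_limsup_lt (by rw [hεs]; linarith) hε.isBoundedUnder_of_range
    filter_upwards [hsub.eventually h1, hsub.eventually (hdec.eventually_lt_const hη2),
      hsub.eventually (eventually_ge_atTop K)] with l e1 e2 hk
    set k := κ (κ' l)
    -- The near-optimality of the trial point passes to `z k` itself, since their values of `Q`
    -- differ by less than `η / 2`.
    have h3 := (A.zTry_opt k 0 (Nat.zero_le _)).2 w hw
    rw [A.cTry_zero, (hK k hk).2] at h3
    linarith
  exact ⟨⟨A.c K, hcpos, eventually_atTop.2 ⟨K, fun k hk => (hK k hk).2⟩, hcrit⟩,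
    fun hf => hcrit.isEpsCritical hP hcpos hf⟩
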